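/- Let $G$ be a finite group and $\mathbb{K}$ a field of characteristic zero. For a finite $G$-set $X$, a vector bundle over $X$ is a functor $V$ to finite-dimensional $\mathbb{K}$-vector spaces from the category whose objects are the points of $X$ and whose arrows $x\to y$ are the $g\in G$ with $g\cdot x=y$; we write $V_x$ for its fibres and $g\cdot e\in V_{g\cdot x}$ for the image of $e\in V_x$ under $g$. Let $K_G^+(X)$ be the commutative semiring of isomorphism classes of vector bundles over $X$ under $\oplus$ and $\otimes$, and let $K_G(X)$ be the commutative ring obtained as the group completion of $(K_G^+(X),\oplus)$, with canonical map $k_X:K_G^+(X)\to K_G(X)$. For a $G$-map $f:X\to Y$ of finite $G$-sets, define the restriction $f^*:K_G^+(Y)\to K_G^+(X)$ and the induction and tensor induction $f_*,f_\sharp:K_G^+(X)\to K_G^+(Y)$ by $$(f^*V)_x=V_{f(x)},\qquad (f_*V)_y=\bigoplus_{x\in f^{-1}(y)}V_x,\qquad (f_\sharp V)_y=\bigotimes_{x\in f^{-1}(y)}V_x,$$ with actions of $g\in G$ given respectively by that on $V$, by $g\cdot(e_x)_x=(g\cdot e_{g^{-1}x})_x$ and by $g\cdot\bigotimes_x e_x=\bigotimes_x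 g\cdot e_{g^{-1}x}$. A semi-Mackey functor is a pair consisting of a contravariant functor $S^*$ and a covariant functor $S_*$ from finite $G$-sets to commutative monoids, with the same values $S(X)$ on objects, such that (a) for every pullback square of finite $G$-sets with $\alpha:\Omega_1\to\Omega_2$, $\beta:\Omega_1\to\Omega_3$, $\gamma:\Omega_2\to\Omega_4$, $\delta:\Omega_3\to\Omega_4$ and $\gamma\alpha=\delta\beta$, one has $S^*(\delta)S_*(\gamma)=S_*(\beta)S^*(\alpha)$; and (b) for all finite $G$-sets $\Omega,\Psi$, the map $S(\Omega)\times S(\Psi)\to S(\Omega\sqcup\Psi)$ whose components are $S_*$ of the two inclusions is an isomorphism. Given $G$-maps $p:Z\to X$ and $f:X\to Y$ of finite $G$-sets, let $\Pi_fZ$ be the $G$-set of pairs $(y,s)$ with $y\in Y$ and $s:f^{-1}(y)\to Z$ such that $p\circ s$ is the inclusion $f^{-1}(y)\subseteq X$; here $g\cdot(y,s)=(g\cdot y,{}^gs)$ with ${}^gs(x)=g\cdot s(g^{-1}\cdot x)$. An exponential diagram is a diagram of $G$-maps $X'\xrightarrow{e}Z\xrightarrow{p}X\xrightarrow{f}Y$,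 $X'\xrightarrow{f'}Y'\xrightarrow{q}Y$ isomorphic to the one with $Y'=\Pi_fZ$, $q(y,s)=y$, $X'=X\times_Y\Pi_fZ$, $e(x,(y,s))=s(x)$ and $f'$ the projection to $\Pi_fZ$. A semi-Tambara functor assigns to each finite $G$-set $X$ a commutative semiring $S(X)$, and to each $G$-map $f:X\to Y$ of finite $G$-sets a semiring homomorphism $f^*:S(Y)\to S(X)$, a homomorphism of additive monoids $f_*:S(X)\to S(Y)$ and a homomorphism of multiplicative monoids $f_\sharp:S(X)\to S(Y)$, such that $(S,f^*,f_*)$ and $(S,f^*,f_\sharp)$ are semi-Mackey functors (for the additive, respectively multiplicative, monoids $S(X)$) and $f_\sharp p_*=q_*f'_\sharp e^*$ for every exponential diagram as above. It is a Tambara functor if every $S(X)$ is a ring and every $f_*$ is a homomorphism of additive groups. A morphism of semi-Tambara functors is a family of semiring homomorphisms commuting with all $f^*$, $f_*$ and $f_\sharp$. Then: 1. $K_G^+(-)$, with restriction, induction and tensor induction, is a semi-Tambara functor. 2. The group completions $K_G(X)$ form a Tambara functor: there are unique families of maps $f^*:K_G(Y)\to K_G(X)$ and $f_*,f_\sharp:K_G(X)\to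 K_G(Y)$, indexed by the $G$-maps $f:X\to Y$ of finite $G$-sets, that make the rings $K_G(X)$ into a Tambara functor for which the maps $k_X$ form a morphism of semi-Tambara functors $K_G^+(-)\to K_G(-)$. -/

import Mathlib

open scoped TensorProduct

universe u w w'

/-! ## Finite `G`-sets -/

/-- A finite set with a left action of the group `G`. -/
structure FinGSet (G : Type u) [Group G] where
  carrier : Type u
  [action : MulAction G carrier]
  [finite : Finite carrier]

namespace FinGSet

variable {G : Type u} [Group G]

instance : CoeSort (FinGSet G) (Type u) := ⟨FinGSet.carrier⟩

attribute [instance] FinGSet.action FinGSet.finite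

/-- The disjoint union `X ⊔ Y`. -/
def disjUnion (X Y : FinGSet G) : FinGSet G where
  carrier := X ⊕ Y

/-- The inclusion `X → X ⊔ Y`. -/
def inl (X Y : FinGSet G) : X →[G] disjUnion X Y where
  toFun x := (Sum.inl x : X ⊕ Y)
  map_smul' _ _ := rfl

/-- The inclusion `Y → X ⊔ Y`. -/
def inr (X Y : FinGSet G) : Y →[G] disjUnion X Y where
  toFun y := (Sum.inr y : X ⊕ Y)
  map_smul' _ _ := rfl

/-- The square
```
  Ω₁ --α--> Ω₂
  |β        |γ
  Ω₃ --δ--> Ω₄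
```
is a pullback square: it commutes, and the induced map from `Ω₁` to the fibre product
`{(x, y) ∈ Ω₂ × Ω₃ | γ x = δ y}` is bijective. -/
def IsPullbackSquare {Ω₁ Ω₂ Ω₃ Ω₄ : FinGSet G} (α : Ω₁ →[G] Ω₂) (β : Ω₁ →[G] Ω₃)
    (γ : Ω₂ →[G] Ω₄) (δ : Ω₃ →[G] Ω₄) : Prop :=
  ∃ comm : ∀ z, γ (α z) = δ (β z),
    Function.Bijective
      (fun z : Ω₁ => (⟨(α z, β z), comm z⟩ : {q : Ω₂ × Ω₃ // γ q.1 = δ q.2}))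

/-- The fibre product `X ×_Z Y` of `f : X → Z` and `g : Y → Z`. -/
def fibreProduct {X Y Z : FinGSet G} (f : X →[G] Z) (g : Y →[G] Z) : FinGSet G where
  carrier := {q : X × Y // f q.1 = g q.2}
  action :=
    { smul := fun a q => ⟨a • q.1, by
        rw [Prod.smul_fst, Prod.smul_snd, map_smul, map_smul, q.2]⟩
      one_smul := fun q => Subtype.ext (one_smul G q.1)
      mul_smul := fun a b q => Subtype.ext (mul_smul a b q.1) }

/-- For `g • y = y'`, the bijection `f⁻¹(y) → f⁻¹(y')`, `x ↦ g • x`. -/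
def fibreEquiv {X Y : FinGSet G} (f : X →[G] Y) (g : G) {y y' : Y} (h : g • y = y') :
    {x : X // f x = y} ≃ {x : X // f x = y'} where
  toFun x := ⟨g • x.1, by rw [map_smul, x.2, h]⟩
  invFun x := ⟨g⁻¹ • x.1, by rw [map_smul, x.2, ← h, inv_smul_smul]⟩
  left_inv x := Subtype.ext (inv_smul_smul g x.1)
  right_inv x := Subtype.ext (smul_inv_smul g x.1)

section Exponential

variable {A X Y : FinGSet G} (p : A →[G] X) (f : X →[G] Y)

/-- The set underlying `Π_f A`: pairs of a point `y` of `Y` and a section over `f⁻¹(y)` of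
`p : A → X`. -/
def PiSections : Type u :=
  Σ y : Y, {s : {x : X // f x = y} → A // ∀ x, p (s x) = x.1}

variable {p f} in
theorem PiSections.ext' {a b : PiSections p f} (h₁ : a.1 = b.1)
    (h₂ : ∀ (x : X) (ha : f x = a.1) (hb : f x = b.1), a.2.1 ⟨x, ha⟩ = b.2.1 ⟨x, hb⟩) :
    a = b := by
  obtain ⟨y, s, hs⟩ := a
  obtain ⟨y', s', hs'⟩ := b
  obtain rfl : y = y' := h₁
  obtain rfl : s = s' := funext fun x => h₂ x.1 x.2 x.2
  rfl

/-- The action of `G` on `Π_f A`: `g` takes a section `s` over `f⁻¹(y)` to the section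
`x ↦ g • s (g⁻¹ • x)` over `f⁻¹(g • y)`. -/
instance : MulAction G (PiSections p f) where
  smul g a := ⟨g • a.1, fun x => g • a.2.1 ((fibreEquiv f g rfl).symm x), fun x => by
    rw [map_smul, a.2.2]; exact smul_inv_smul g x.1⟩
  one_smul a := by
    refine PiSections.ext' (one_smul G a.1) fun x ha hb => ?_
    refine (one_smul G _).trans (congrArg a.2.1 (Subtype.ext ?_))
    change (1 : G)⁻¹ • x = x
    rw [inv_one, one_smul]
  mul_smul g g' a := by
    refine PiSections.ext' (mul_smul g g' a.1) fun x ha hb => ?_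
    refine (mul_smul g g' _).trans
      (congrArg (fun t => g • g' • a.2.1 t) (Subtype.ext ?_))
    change (g * g')⁻¹ • x = g'⁻¹ • g⁻¹ • x
    rw [mul_inv_rev, mul_smul]

/-- The finite `G`-set `Π_f A` attached to `p : A → X` and `f : X → Y`. -/
def piSet : FinGSet G where
  carrier := PiSections p f
  finite := inferInstanceAs
    (Finite (Σ y : Y, {s : {x : X // f x = y} → A // ∀ x, p (s x) = x.1}))

/-- The structure map `q : Π_f A → Y`. -/
def piProj : piSet p f →[G] Y where
  toFun a := Sigma.fst a
  map_smul' _ _ := rfl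

/-- The evaluation `X ×_Y Π_f A → A`, `(x, s) ↦ s x`. -/
def piEval : fibreProduct f (piProj p f) →[G] A where
  toFun z := z.1.2.2.1 ⟨z.1.1, z.2⟩
  map_smul' g z := by
    change g • z.1.2.2.1 _ = g • z.1.2.2.1 _
    exact congrArg (fun t => g • z.1.2.2.1 t) (Subtype.ext (inv_smul_smul g z.1.1))

/-- The projection `X ×_Y Π_f A → Π_f A`. -/
def piSnd : fibreProduct f (piProj p f) →[G] piSet p f where
  toFun z := z.1.2
  map_smul' _ _ := rfl

end Exponential

/-- The diagram
```
  X' --e--> Z --p--> X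
  |f'                |f
  Y' -------q------> Y
```
is an exponential diagram: it is isomorphic, by isomorphisms `a : X' ≅ X ×_Y Π_f Z` and
`b : Y' ≅ Π_f Z` (and identities at the other corners), to the diagram
```
  X ×_Y Π_f Z --> Z --p--> X
      |                    |f
    Π_f Z ---------------> Y
``` -/
def IsExponential {X' Z X Y' Y : FinGSet G} (e : X' →[G] Z) (p : Z →[G] X) (f : X →[G] Y)
    (f' : X' →[G] Y') (q : Y' →[G] Y) : Prop :=
  ∃ (a : X' →[G] fibreProduct f (piProj p f)) (b : Y' →[G] piSet p f),
    Function.Bijective a ∧ Function.Bijective b ∧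
    (∀ x, piEval p f (a x) = e x) ∧
    (∀ x, piSnd p f (a x) = b (f' x)) ∧
    (∀ y, piProj p f (b y) = q y)

end FinGSet

/-! ## Semi-Mackey, semi-Tambara and Tambara functors -/

/-- `(S, res, push)` is a semi-Mackey functor on the finite `G`-sets: a contravariant functor
`res` and a covariant functor `push` to commutative monoids (written additively) that agree on
objects, satisfy base change along pullback squares, and take disjoint unions to products. -/
structure IsSemiMackey {G : Type u} [Group G] (S : FinGSet G → Type w)
    [∀ X, AddCommMonoid (S X)]
    (res : ∀ {X Y : FinGSet G}, (X →[G] Y) → S Y → S X)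
    (push : ∀ {X Y : FinGSet G}, (X →[G] Y) → S X → S Y) : Prop where
  res_zero : ∀ {X Y : FinGSet G} (f : X →[G] Y), res f 0 = 0
  res_add : ∀ {X Y : FinGSet G} (f : X →[G] Y) (a b : S Y), res f (a + b) = res f a + res f b
  push_zero : ∀ {X Y : FinGSet G} (f : X →[G] Y), push f 0 = 0
  push_add : ∀ {X Y : FinGSet G} (f : X →[G] Y) (a b : S X),
    push f (a + b) = push f a + push f b
  res_id : ∀ {X : FinGSet G} (a : S X), res (MulActionHom.id G : X →[G] X) a = a
  res_comp : ∀ {X Y Z : FinGSet G} (g : Y →[G] Z) (f : X →[G] Y) (a : S Z),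
    res (g.comp f) a = res f (res g a)
  push_id : ∀ {X : FinGSet G} (a : S X), push (MulActionHom.id G : X →[G] X) a = a
  push_comp : ∀ {X Y Z : FinGSet G} (g : Y →[G] Z) (f : X →[G] Y) (a : S X),
    push (g.comp f) a = push g (push f a)
  base_change : ∀ {Ω₁ Ω₂ Ω₃ Ω₄ : FinGSet G} (α : Ω₁ →[G] Ω₂) (β : Ω₁ →[G] Ω₃)
    (γ : Ω₂ →[G] Ω₄) (δ : Ω₃ →[G] Ω₄), FinGSet.IsPullbackSquare α β γ δ →
    ∀ a : S Ω₂, res δ (push γ a) = push β (res α a)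
  disjUnion : ∀ Ω Ψ : FinGSet G, Function.Bijective
    (fun c : S Ω × S Ψ => push (FinGSet.inl Ω Ψ) c.1 + push (FinGSet.inr Ω Ψ) c.2)

/-- Three families of maps `f^* = res f`, `f_* = tr f`, `f_♯ = nm f` between the sets `S X`,
indexed by the maps `f : X → Y` of finite `G`-sets. -/
structure TambaraMaps {G : Type u} [Group G] (S : FinGSet G → Type w) where
  res : ∀ {X Y : FinGSet G}, (X →[G] Y) → S Y → S X
  tr : ∀ {X Y : FinGSet G}, (X →[G] Y) → S X → S Y
  nm : ∀ {X Y : FinGSet G}, (X →[G] Y) → S X → S Y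

/-- The commutative semirings `S X` with the maps `f^*`, `f_*`, `f_♯` form a semi-Tambara
functor. The first two conditions contain that `f^*` is a homomorphism of semirings, `f_*` one of
additive monoids and `f_♯` one of multiplicative monoids; `Additive (S X)` is the multiplicative
monoid of `S X` written additively. -/
structure IsSemiTambara {G : Type u} [Group G] {S : FinGSet G → Type w}
    [∀ X, CommSemiring (S X)] (T : TambaraMaps S) : Prop where
  additive : IsSemiMackey S T.res T.tr
  multiplicative : IsSemiMackey (fun X => Additive (S X))
    (fun f a => Additive.ofMul (T.res f a.toMul)) (fun f a => Additive.ofMul (T.nm f a.toMul))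
  exponential : ∀ {X' Z X Y' Y : FinGSet G} (e : X' →[G] Z) (p : Z →[G] X) (f : X →[G] Y)
    (f' : X' →[G] Y') (q : Y' →[G] Y), FinGSet.IsExponential e p f f' q →
    ∀ a : S Z, T.nm f (T.tr p a) = T.tr q (T.nm f' (T.res e a))

/-- A semi-Tambara functor is a Tambara functor if the `S X` are rings and the `f_*` are
homomorphisms of additive groups. -/
structure IsTambara {G : Type u} [Group G] {S : FinGSet G → Type w}
    [∀ X, CommRing (S X)] (T : TambaraMaps S) : Prop extends IsSemiTambara T where
  tr_neg : ∀ {X Y : FinGSet G} (f : X →[G] Y) (a : S X), T.tr f (-a) = -T.tr f a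

/-- The maps `k X : S X → S' X` form a morphism of semi-Tambara functors: they are semiring
homomorphisms commuting with `f^*`, `f_*` and `f_♯`. -/
structure IsTambaraHom {G : Type u} [Group G] {S : FinGSet G → Type w} {S' : FinGSet G → Type w'}
    [∀ X, CommSemiring (S X)] [∀ X, CommSemiring (S' X)]
    (T : TambaraMaps S) (T' : TambaraMaps S') (k : ∀ X, S X → S' X) : Prop where
  map_zero : ∀ X, k X 0 = 0
  map_one : ∀ X, k X 1 = 1
  map_add : ∀ X (a b : S X), k X (a + b) = k X a + k X b
  map_mul : ∀ X (a b : S X), k X (a * b) = k X a * k X b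
  map_res : ∀ {X Y : FinGSet G} (f : X →[G] Y) (a : S Y), k X (T.res f a) = T'.res f (k Y a)
  map_tr : ∀ {X Y : FinGSet G} (f : X →[G] Y) (a : S X), k Y (T.tr f a) = T'.tr f (k X a)
  map_nm : ∀ {X Y : FinGSet G} (f : X →[G] Y) (a : S X), k Y (T.nm f a) = T'.nm f (k X a)

/-! ## Equivariant vector bundles on finite `G`-sets -/

/-- A `G`-equivariant vector bundle over `K` on the finite `G`-set `X`, that is, a functor to the
finite-dimensional `K`-vector spaces from the category with objects the points of `X` and with
arrows `x ⟶ y` the elements `g` of `G` with `g • x = y`. -/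
structure GBundle (K : Type u) [Field K] {G : Type u} [Group G] (X : FinGSet G) where
  fib : X → Type u
  [addCommGroup : ∀ x, AddCommGroup (fib x)]
  [module : ∀ x, Module K (fib x)]
  [finite : ∀ x, Module.Finite K (fib x)]
  map : ∀ (g : G) {x y : X}, g • x = y → (fib x →ₗ[K] fib y)
  map_one : ∀ {x : X} (h : (1 : G) • x = x), map 1 h = LinearMap.id
  map_mul : ∀ (g g' : G) {x y z : X} (h' : g' • x = y) (h : g • y = z) (h'' : (g * g') • x = z),
    map (g * g') h'' = map g h ∘ₗ map g' h'

attribute [instance] GBundle.addCommGroup GBundle.module GBundle.finite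

namespace GBundle

variable {K : Type u} [Field K] {G : Type u} [Group G]

/-- An isomorphism of vector bundles, that is, a natural isomorphism of functors. -/
structure Iso {X : FinGSet G} (V W : GBundle K X) where
  equiv : ∀ x, V.fib x ≃ₗ[K] W.fib x
  comm : ∀ (g : G) {x y : X} (h : g • x = y) (v : V.fib x),
    equiv y (V.map g h v) = W.map g h (equiv x v)

/-- Isomorphism of vector bundles as an equivalence relation. -/
instance isoSetoid (K : Type u) [Field K] {G : Type u} [Group G] (X : FinGSet G) :
    Setoid (GBundle K X) where
  r V W := Nonempty (Iso V W)
  iseqv :=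
    { refl := fun V => ⟨⟨fun _ => LinearEquiv.refl K _, fun _ _ _ _ _ => rfl⟩⟩
      symm := fun {V W} ⟨i⟩ => ⟨⟨fun x => (i.equiv x).symm, fun g x y h w => by
        rw [LinearEquiv.symm_apply_eq, i.comm, LinearEquiv.apply_symm_apply]⟩⟩
      trans := fun {U V W} ⟨i⟩ ⟨j⟩ => ⟨⟨fun x => (i.equiv x).trans (j.equiv x),
        fun g x y h u => by
          simp only [LinearEquiv.trans_apply, i.comm, j.comm]⟩⟩ }

theorem map_congr {X : FinGSet G} (V : GBundle K X) {ι : Type u} {j : ι → X}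
    (m : ∀ i, V.fib (j i)) {g g' : G} (hg : g = g') {a b : ι} (hab : a = b) {y : X}
    (ha : g • j a = y) (hb : g' • j b = y) : V.map g ha (m a) = V.map g' hb (m b) := by
  subst hg hab
  rfl

section Operations

variable {X : FinGSet G}

/-- The zero bundle. -/
def zero (K : Type u) [Field K] (X : FinGSet G) : GBundle K X where
  fib _ := PUnit
  map _ _ _ _ := LinearMap.id
  map_one _ := rfl
  map_mul _ _ _ _ _ _ _ _ := rfl

/-- The trivial line bundle. -/
def one (K : Type u) [Field K] (X : FinGSet G) : GBundle K X where
  fib _ := K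
  map _ _ _ _ := LinearMap.id
  map_one _ := rfl
  map_mul _ _ _ _ _ _ _ _ := rfl

/-- The direct sum `V ⊕ W`. -/
def add (V W : GBundle K X) : GBundle K X where
  fib x := V.fib x × W.fib x
  map g _ _ h := (V.map g h).prodMap (W.map g h)
  map_one h := by rw [V.map_one, W.map_one, LinearMap.prodMap_id]
  map_mul g g' _ _ _ h' h h'' := by
    rw [V.map_mul g g' h' h, W.map_mul g g' h' h, LinearMap.prodMap_comp]

/-- The tensor product `V ⊗ W`. -/
noncomputable def mul (V W : GBundle K X) : GBundle K X where
  fib x := V.fib x ⊗[K] W.fib x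
  map g _ _ h := TensorProduct.map (V.map g h) (W.map g h)
  map_one h := by rw [V.map_one, W.map_one, TensorProduct.map_id]
  map_mul g g' _ _ _ h' h h'' := by
    rw [V.map_mul g g' h' h, W.map_mul g g' h' h, TensorProduct.map_comp]

/-- Direct sums of isomorphisms. -/
def Iso.add {V V' W W' : GBundle K X} (i : Iso V V') (j : Iso W W') :
    Iso (V.add W) (V'.add W') where
  equiv x := (i.equiv x).prodCongr (j.equiv x)
  comm g _ _ h v := Prod.ext (i.comm g h v.1) (j.comm g h v.2)

/-- Tensor products of isomorphisms. -/
noncomputable def Iso.mul {V V' W W' : GBundle K X} (i : Iso V V') (j : Iso W W') :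
    Iso (V.mul W) (V'.mul W') where
  equiv x := TensorProduct.congr (i.equiv x) (j.equiv x)
  comm g x y h v := by
    have H : (TensorProduct.congr (i.equiv y) (j.equiv y)).toLinearMap ∘ₗ
          TensorProduct.map (V.map g h) (W.map g h) =
        TensorProduct.map (V'.map g h) (W'.map g h) ∘ₗ
          (TensorProduct.congr (i.equiv x) (j.equiv x)).toLinearMap :=
      TensorProduct.ext' fun a b => by simp [i.comm, j.comm]
    exact LinearMap.congr_fun H v

end Operations

section Functoriality

variable {X Y : FinGSet G} (f : X →[G] Y)

/-- The restriction `f^* V`, with fibres `(f^* V)_x = V_{f x}`. -/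
def res (V : GBundle K Y) : GBundle K X where
  fib x := V.fib (f x)
  map g _ _ h := V.map g (by rw [← map_smul, h])
  map_one _ := V.map_one _
  map_mul g g' _ _ _ _ _ _ := V.map_mul g g' _ _ _

/-- For `g • y = y'`, the family `(g • e_{g⁻¹ • x})_x` over `f⁻¹(y')` made from a family
`(e_x)_x` over `f⁻¹(y)`. -/
def moveFamily (V : GBundle K X) (g : G) {y y' : Y} (h : g • y = y')
    (e : ∀ x : {x : X // f x = y}, V.fib x.1) (x : {x : X // f x = y'}) : V.fib x.1 :=
  V.map g (x := ((FinGSet.fibreEquiv f g h).symm x).1) (smul_inv_smul g x.1)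
    (e ((FinGSet.fibreEquiv f g h).symm x))

theorem moveFamily_one (V : GBundle K X) {y : Y} (h : (1 : G) • y = y)
    (e : ∀ x : {x : X // f x = y}, V.fib x.1) : V.moveFamily f 1 h e = e := by
  funext x
  refine (V.map_congr (j := fun x : {x : X // f x = y} => x.1) e rfl
    (a := (FinGSet.fibreEquiv f 1 h).symm x) (b := x) (Subtype.ext ?_)
    (smul_inv_smul (1 : G) x.1) (one_smul G x.1)).trans ?_
  · change (1 : G)⁻¹ • x.1 = x.1
    rw [inv_one, one_smul]
  · rw [V.map_one]; rfl

theorem moveFamily_mul (V : GBundle K X) (g g' : G) {y₁ y₂ y₃ : Y} (h' : g' • y₁ = y₂)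
    (h : g • y₂ = y₃) (h'' : (g * g') • y₁ = y₃) (e : ∀ x : {x : X // f x = y₁}, V.fib x.1) :
    V.moveFamily f (g * g') h'' e = V.moveFamily f g h (V.moveFamily f g' h' e) := by
  funext x
  have hx : g' • g'⁻¹ • g⁻¹ • x.1 = g⁻¹ • x.1 := smul_inv_smul _ _
  refine (V.map_congr (j := fun x : {x : X // f x = y₁} => x.1) e rfl
    (a := (FinGSet.fibreEquiv f (g * g') h'').symm x)
    (b := (FinGSet.fibreEquiv f g' h').symm ((FinGSet.fibreEquiv f g h).symm x))
    (Subtype.ext ?_) (smul_inv_smul (g * g') x.1) ?_).trans ?_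
  · change (g * g')⁻¹ • x.1 = g'⁻¹ • g⁻¹ • x.1
    rw [mul_inv_rev, mul_smul]
  · change (g * g') • g'⁻¹ • g⁻¹ • x.1 = x.1
    rw [mul_smul, hx, smul_inv_smul]
  · exact LinearMap.congr_fun (V.map_mul g g' hx (smul_inv_smul g x.1) _) _

/-- The induction `f_* V`, with fibres `(f_* V)_y = ⨁_{x ∈ f⁻¹(y)} V_x` (a finite direct sum,
written as a product) and action `g • (e_x)_x = (g • e_{g⁻¹ • x})_x`. -/
def ind (V : GBundle K X) : GBundle K Y where
  fib y := ∀ x : {x : X // f x = y}, V.fib x.1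
  map g _ _ h :=
    { toFun := V.moveFamily f g h
      map_add' := fun _ _ => funext fun _ => map_add _ _ _
      map_smul' := fun _ _ => funext fun _ => map_smul _ _ _ }
  map_one h := LinearMap.ext (V.moveFamily_one f h)
  map_mul g g' _ _ _ h' h h'' := LinearMap.ext (V.moveFamily_mul f g g' h' h h'')

/-- The map `⨂_{x ∈ f⁻¹(y)} V_x → ⨂_{x ∈ f⁻¹(y')} V_x`, `⨂_x e_x ↦ ⨂_x g • e_{g⁻¹ • x}`. -/
noncomputable def normMap (V : GBundle K X) (g : G) {y y' : Y} (h : g • y = y') :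
    (⨂[K] x : {x : X // f x = y}, V.fib x.1) →ₗ[K] ⨂[K] x : {x : X // f x = y'}, V.fib x.1 :=
  PiTensorProduct.map (fun x => V.map g (x := ((FinGSet.fibreEquiv f g h).symm x).1)
      (smul_inv_smul g x.1)) ∘ₗ
    (PiTensorProduct.reindex K (fun x => V.fib x.1) (FinGSet.fibreEquiv f g h)).toLinearMap

theorem normMap_tprod (V : GBundle K X) (g : G) {y y' : Y} (h : g • y = y')
    (e : ∀ x : {x : X // f x = y}, V.fib x.1) :
    V.normMap f g h (PiTensorProduct.tprod K e) = PiTensorProduct.tprod K (V.moveFamily f g h e) := by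
  rw [normMap, LinearMap.comp_apply, LinearEquiv.coe_coe, PiTensorProduct.reindex_tprod]
  exact PiTensorProduct.map_tprod _ _

/-- The norm (tensor induction) `f_♯ V`, with fibres `(f_♯ V)_y = ⨂_{x ∈ f⁻¹(y)} V_x` and action
`g • (⨂_x e_x) = ⨂_x g • e_{g⁻¹ • x}`. -/
noncomputable def norm (V : GBundle K X) : GBundle K Y where
  fib y := ⨂[K] x : {x : X // f x = y}, V.fib x.1
  map g _ _ h := V.normMap f g h
  map_one h := PiTensorProduct.ext (MultilinearMap.ext fun e => by
    simp only [LinearMap.compMultilinearMap_apply, normMap_tprod, moveFamily_one,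
      LinearMap.id_apply])
  map_mul g g' _ _ _ h' h h'' := PiTensorProduct.ext (MultilinearMap.ext fun e => by
    simp only [LinearMap.compMultilinearMap_apply, LinearMap.comp_apply, normMap_tprod,
      V.moveFamily_mul f g g' h' h h''])

/-- Restriction of isomorphisms. -/
def Iso.res {V W : GBundle K Y} (i : Iso V W) : Iso (V.res f) (W.res f) where
  equiv x := i.equiv (f x)
  comm g _ _ _ v := i.comm g _ v

/-- Induction of isomorphisms. -/
def Iso.ind {V W : GBundle K X} (i : Iso V W) : Iso (V.ind f) (W.ind f) where
  equiv _ := LinearEquiv.piCongrRight fun x => i.equiv x.1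
  comm g _ _ _ _ := funext fun _ => i.comm g _ _

/-- Tensor induction of isomorphisms. -/
noncomputable def Iso.norm {V W : GBundle K X} (i : Iso V W) :
    Iso (V.norm f) (W.norm f) where
  equiv _ := PiTensorProduct.congr fun x => i.equiv x.1
  comm g y y' h v := by
    have H : (PiTensorProduct.congr fun x : {x : X // f x = y'} => i.equiv x.1).toLinearMap ∘ₗ
        V.normMap f g h = W.normMap f g h ∘ₗ
        (PiTensorProduct.congr fun x : {x : X // f x = y} => i.equiv x.1).toLinearMap := by
      refine PiTensorProduct.ext (MultilinearMap.ext fun e => ?_)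
      simp only [LinearMap.compMultilinearMap_apply, LinearMap.comp_apply, LinearEquiv.coe_coe,
        normMap_tprod, PiTensorProduct.congr_tprod]
      exact congrArg _ (funext fun x => i.comm g _ _)
    exact LinearMap.congr_fun H v

end Functoriality

end GBundle

/-! ## The semiring of isomorphism classes of vector bundles -/

/-- `K_G^+(X)`: the isomorphism classes of vector bundles over `X`. -/
def KPlus (K : Type u) [Field K] {G : Type u} [Group G] (X : FinGSet G) : Type (u + 1) :=
  Quotient (GBundle.isoSetoid K X)

namespace KPlus

variable {K : Type u} [Field K] {G : Type u} [Group G]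

/-- The class of a vector bundle. -/
def mk {X : FinGSet G} (V : GBundle K X) : KPlus K X := Quotient.mk _ V

section Semiring

variable {X : FinGSet G}

theorem mk_eq_mk {V W : GBundle K X} (i : GBundle.Iso V W) : mk V = mk W :=
  Quotient.sound ⟨i⟩

/-- Addition is the direct sum, multiplication the tensor product. -/
noncomputable instance : CommSemiring (KPlus K X) where
  zero := mk (GBundle.zero K X)
  one := mk (GBundle.one K X)
  add := Quotient.map₂ GBundle.add fun _ _ ⟨i⟩ _ _ ⟨j⟩ => ⟨i.add j⟩
  mul := Quotient.map₂ GBundle.mul fun _ _ ⟨i⟩ _ _ ⟨j⟩ => ⟨i.mul j⟩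
  nsmul := @nsmulRec _ ⟨mk (GBundle.zero K X)⟩
    ⟨Quotient.map₂ GBundle.add fun _ _ ⟨i⟩ _ _ ⟨j⟩ => ⟨i.add j⟩⟩
  nsmul_zero _ := rfl
  nsmul_succ _ _ := rfl
  add_assoc := by
    rintro ⟨U⟩ ⟨V⟩ ⟨W⟩
    exact mk_eq_mk ⟨fun x => LinearEquiv.prodAssoc K _ _ _, fun _ _ _ _ _ => rfl⟩
  add_comm := by
    rintro ⟨V⟩ ⟨W⟩
    exact mk_eq_mk ⟨fun x => LinearEquiv.prodComm K _ _, fun _ _ _ _ _ => rfl⟩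
  zero_add := by
    rintro ⟨V⟩
    exact mk_eq_mk ⟨fun x => (LinearEquiv.uniqueProd : (PUnit.{u + 1} × V.fib x) ≃ₗ[K] V.fib x),
      fun _ _ _ _ _ => rfl⟩
  add_zero := by
    rintro ⟨V⟩
    exact mk_eq_mk ⟨fun x => (LinearEquiv.prodUnique : (V.fib x × PUnit.{u + 1}) ≃ₗ[K] V.fib x),
      fun _ _ _ _ _ => rfl⟩
  mul_assoc := by
    rintro ⟨U⟩ ⟨V⟩ ⟨W⟩
    exact mk_eq_mk ⟨fun x => TensorProduct.assoc K _ _ _, fun g x y h v =>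
      LinearMap.congr_fun (TensorProduct.map_map_comp_assoc_eq (U.map g h) (V.map g h)
        (W.map g h)).symm v⟩
  mul_comm := by
    rintro ⟨V⟩ ⟨W⟩
    exact mk_eq_mk ⟨fun x => TensorProduct.comm K _ _, fun g x y h v =>
      (TensorProduct.map_comm (W.map g h) (V.map g h) v).symm⟩
  one_mul := by
    rintro ⟨V⟩
    refine mk_eq_mk ⟨fun x => TensorProduct.lid K _, fun g x y h v => ?_⟩
    have H : (TensorProduct.lid K (V.fib y)).toLinearMap ∘ₗ
        TensorProduct.map LinearMap.id (V.map g h) =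
        V.map g h ∘ₗ (TensorProduct.lid K (V.fib x)).toLinearMap :=
      TensorProduct.ext' fun a b => by simp
    exact LinearMap.congr_fun H v
  mul_one := by
    rintro ⟨V⟩
    refine mk_eq_mk ⟨fun x => TensorProduct.rid K _, fun g x y h v => ?_⟩
    have H : (TensorProduct.rid K (V.fib y)).toLinearMap ∘ₗ
        TensorProduct.map (V.map g h) LinearMap.id =
        V.map g h ∘ₗ (TensorProduct.rid K (V.fib x)).toLinearMap :=
      TensorProduct.ext' fun a b => by simp
    exact LinearMap.congr_fun H v
  zero_mul := by
    rintro ⟨V⟩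
    have h₁ (x : X) : Subsingleton (((GBundle.zero K X).mul V).fib x) :=
      inferInstanceAs (Subsingleton (PUnit.{u + 1} ⊗[K] V.fib x))
    have h₂ (x : X) : Subsingleton ((GBundle.zero K X).fib x) :=
      inferInstanceAs (Subsingleton PUnit)
    exact mk_eq_mk ⟨fun x => LinearEquiv.ofSubsingleton _ _, fun _ _ _ _ _ => rfl⟩
  mul_zero := by
    rintro ⟨V⟩
    have h₁ (x : X) : Subsingleton ((V.mul (GBundle.zero K X)).fib x) :=
      inferInstanceAs (Subsingleton (V.fib x ⊗[K] PUnit.{u + 1}))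
    have h₂ (x : X) : Subsingleton ((GBundle.zero K X).fib x) :=
      inferInstanceAs (Subsingleton PUnit)
    exact mk_eq_mk ⟨fun x => LinearEquiv.ofSubsingleton _ _, fun _ _ _ _ _ => rfl⟩
  left_distrib := by
    rintro ⟨U⟩ ⟨V⟩ ⟨W⟩
    refine mk_eq_mk ⟨fun x => TensorProduct.prodRight K K _ _ _, fun g x y h v => ?_⟩
    have H : (TensorProduct.prodRight K K (U.fib y) (V.fib y) (W.fib y)).toLinearMap ∘ₗ
          TensorProduct.map (U.map g h) ((V.map g h).prodMap (W.map g h)) =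
        (TensorProduct.map (U.map g h) (V.map g h)).prodMap
          (TensorProduct.map (U.map g h) (W.map g h)) ∘ₗ
          (TensorProduct.prodRight K K (U.fib x) (V.fib x) (W.fib x)).toLinearMap :=
      TensorProduct.ext' fun a b => rfl
    exact LinearMap.congr_fun H v
  right_distrib := by
    rintro ⟨U⟩ ⟨V⟩ ⟨W⟩
    refine mk_eq_mk ⟨fun x => TensorProduct.prodLeft K K _ _ _, fun g x y h v => ?_⟩
    have H : (TensorProduct.prodLeft K K (U.fib y) (V.fib y) (W.fib y)).toLinearMap ∘ₗ
          TensorProduct.map ((U.map g h).prodMap (V.map g h)) (W.map g h) =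
        (TensorProduct.map (U.map g h) (W.map g h)).prodMap
          (TensorProduct.map (V.map g h) (W.map g h)) ∘ₗ
          (TensorProduct.prodLeft K K (U.fib x) (V.fib x) (W.fib x)).toLinearMap :=
      TensorProduct.ext' fun a b => rfl
    exact LinearMap.congr_fun H v

end Semiring

/-- Restriction, induction and tensor induction on isomorphism classes of vector bundles. -/
noncomputable def maps (K : Type u) [Field K] (G : Type u) [Group G] :
    TambaraMaps (fun X : FinGSet G => KPlus K X) where
  res f := Quotient.map (GBundle.res f) fun _ _ ⟨i⟩ => ⟨i.res f⟩
  tr f := Quotient.map (GBundle.ind f) fun _ _ ⟨i⟩ => ⟨i.ind f⟩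
  nm f := Quotient.map (GBundle.norm f) fun _ _ ⟨i⟩ => ⟨i.norm f⟩

end KPlus

/-! ## Group completion -/

namespace GroupCompletion

open Algebra

variable {R : Type w} [CommSemiring R]

theorem lift_of {A : Type w'} [AddCommGroup A] (φ : R →+ A) (a : R) :
    GrothendieckAddGroup.lift φ (GrothendieckAddGroup.of a) = φ a :=
  DFunLike.congr_fun (GrothendieckAddGroup.lift.symm_apply_apply φ) a

theorem hom_ext {A : Type w'} [AddCommGroup A] {φ ψ : GrothendieckAddGroup R →+ A}
    (h : ∀ a : R, φ (GrothendieckAddGroup.of a) = ψ (GrothendieckAddGroup.of a)) : φ = ψ :=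
  GrothendieckAddGroup.lift.symm.injective (AddMonoidHom.ext h)

/-- The biadditive extension to the group completion of the multiplication of a semiring. -/
noncomputable def mulHom (R : Type w) [CommSemiring R] :
    GrothendieckAddGroup R →+ GrothendieckAddGroup R →+ GrothendieckAddGroup R :=
  GrothendieckAddGroup.lift
    { toFun := fun r => GrothendieckAddGroup.lift
        ((GrothendieckAddGroup.of (M := R)).comp (AddMonoidHom.mulLeft r))
      map_zero' := hom_ext fun s => by
        rw [lift_of, AddMonoidHom.comp_apply, AddMonoidHom.coe_mulLeft, zero_mul, map_zero,
          AddMonoidHom.zero_apply]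
      map_add' := fun r r' => hom_ext fun s => by
        simp only [AddMonoidHom.add_apply, lift_of, AddMonoidHom.comp_apply,
          AddMonoidHom.coe_mulLeft, add_mul, map_add] }

theorem mulHom_of (a b : R) : mulHom R (GrothendieckAddGroup.of a) (GrothendieckAddGroup.of b) =
    GrothendieckAddGroup.of (a * b) := by
  rw [mulHom, lift_of]
  exact lift_of _ b

theorem exists_sub (z : GrothendieckAddGroup R) :
    ∃ a b : R, z = GrothendieckAddGroup.of a - GrothendieckAddGroup.of b := by
  obtain ⟨⟨a, b⟩, h⟩ := (AddLocalization.addMonoidOf (⊤ : AddSubmonoid R)).surj z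
  exact ⟨a, b, eq_sub_of_add_eq h⟩

/-- The ring structure on the group completion of a commutative semiring `R` for which
`R → GrothendieckAddGroup R` is a homomorphism of semirings. -/
noncomputable instance : CommRing (GrothendieckAddGroup R) where
  __ := (inferInstance : AddCommGroup (GrothendieckAddGroup R))
  mul x y := mulHom R x y
  one := GrothendieckAddGroup.of 1
  left_distrib x y z := map_add (mulHom R x) y z
  right_distrib x y z := DFunLike.congr_fun (map_add (mulHom R) x y) z
  zero_mul x := DFunLike.congr_fun (map_zero (mulHom R)) x
  mul_zero x := map_zero (mulHom R x)
  mul_assoc x y z := by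
    obtain ⟨a, b, rfl⟩ := exists_sub x
    obtain ⟨c, d, rfl⟩ := exists_sub y
    obtain ⟨e, f, rfl⟩ := exists_sub z
    change mulHom R (mulHom R _ _) _ = mulHom R _ (mulHom R _ _)
    simp only [map_sub, AddMonoidHom.sub_apply, mulHom_of, mul_assoc]
  mul_comm x y := by
    obtain ⟨a, b, rfl⟩ := exists_sub x
    obtain ⟨c, d, rfl⟩ := exists_sub y
    change mulHom R _ _ = mulHom R _ _
    simp only [map_sub, AddMonoidHom.sub_apply, mulHom_of, mul_comm c, mul_comm d]
    abel
  one_mul x := by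
    obtain ⟨a, b, rfl⟩ := exists_sub x
    change mulHom R (GrothendieckAddGroup.of 1) _ = _
    simp only [map_sub, mulHom_of, one_mul]
  mul_one x := by
    obtain ⟨a, b, rfl⟩ := exists_sub x
    change mulHom R _ (GrothendieckAddGroup.of 1) = _
    simp only [map_sub, AddMonoidHom.sub_apply, mulHom_of, mul_one]

end GroupCompletion

/-- `K_G(X)`: the Grothendieck ring of vector bundles over `X`, that is, the group completion of
`K_G^+(X)`. -/
abbrev KGroup (K : Type u) [Field K] {G : Type u} [Group G] (X : FinGSet G) : Type (u + 1) :=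
  Algebra.GrothendieckAddGroup (KPlus K X)

/-! For isomorphism classes of bundles, every axiom is witnessed by a canonical isomorphism. The
fibres of `f_* V` and `f_♯ V` are a sum and a tensor product over a fibre of `f`, so functoriality
and base change come from bijections between fibres: the fibre of a composite is a disjoint union of
fibres, and a pullback square identifies fibres. The exponential axiom is distributivity: a tensor
product over `x` of sums over `p⁻¹(x)` is the sum, over all sections of `p` above `f⁻¹(y)`, of
tensor products (`exists_expEquiv`, `normInd`). Isomorphisms out of a tensor product need only be
checked for equivariance on pure tensors (`isoOfNorm`).

The group completion is treated for any semi-Tambara functor. Restriction and induction are additive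
and extend at once. The norm is not additive, but it is polynomial. Applying the exponential axiom
to the codiagonal of `X` expands `f_♯(u + v)` over the decompositions of the fibres of `f` into two
parts (`nm_add`). One decomposition gives `f_♯ u`; in all others, `u` enters through a norm along a
map with strictly smaller fibres. By induction on the fibre size, all `(n + 1)`-fold differences of
`f_♯` vanish when the fibres have at most `n` points (`hasDegreeLE_nm`).

A polynomial map from a commutative monoid to an abelian group extends to the group completion
(`exists_extension`), and two polynomial maps there agree as soon as they agree on the image of the
monoid (`eq_of_forall_of`). The first fact constructs the norms and the second carries over all
identities. For `(gf)_♯ = g_♯ f_♯` one needs in addition that a norm composed with a polynomial map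
is polynomial (`exists_hasDegreeLE_nmExt_comp`). The norms of any Tambara structure on the
completions are polynomial for the same reason, whence uniqueness. -/

/-! ### Tensor products over finite index sets. -/

namespace PiTensorProduct

variable {K : Type*} [Field K]

/-- Pulling back the factors of a tensor product along a bijection of the index sets. -/
noncomputable def pullEquiv {I J : Type*} (M : I → Type*) [∀ i, AddCommGroup (M i)]
    [∀ i, Module K (M i)] (σ : J ≃ I) : (⨂[K] i, M i) ≃ₗ[K] ⨂[K] j, M (σ j) :=
  reindex K M σ.symm

theorem pullEquiv_tprod {I J : Type*} (M : I → Type*) [∀ i, AddCommGroup (M i)]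
    [∀ i, Module K (M i)] (σ : J ≃ I) (e : ∀ i, M i) :
    pullEquiv M σ (tprod K e) = tprod K fun j => e (σ j) :=
  reindex_tprod _ _

section Mul

variable {I : Type*} (M N : I → Type*) [∀ i, AddCommGroup (M i)]
  [∀ i, Module K (M i)] [∀ i, AddCommGroup (N i)] [∀ i, Module K (N i)]

/-- The canonical map `(⨂ M i) ⊗ (⨂ N i) → ⨂ (M i ⊗ N i)`. -/
noncomputable def tensorMap : (⨂[K] i, M i) ⊗[K] (⨂[K] i, N i) →ₗ[K] ⨂[K] i, (M i ⊗[K] N i) :=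
  TensorProduct.lift (map₂ fun i => TensorProduct.mk K (M i) (N i))

theorem tensorMap_tmul (a : ∀ i, M i) (b : ∀ i, N i) :
    tensorMap M N (tprod K a ⊗ₜ tprod K b) = tprod K fun i => a i ⊗ₜ b i := by
  simp [tensorMap, map₂_tprod_tprod]

/-- Pure tensors of basis vectors form bases on both sides, and the map matches them through the
bijection between functions into a product and pairs of functions. -/
theorem tensorMap_bijective [Finite I] : Function.Bijective (tensorMap (K := K) M N) := by
  let bM := fun i => Module.Basis.ofVectorSpace K (M i)
  let bN := fun i => Module.Basis.ofVectorSpace K (N i)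
  let E := ((Basis.piTensorProduct bM).tensorProduct (Basis.piTensorProduct bN)).equiv
    (Basis.piTensorProduct fun i => (bM i).tensorProduct (bN i))
    (Equiv.arrowProdEquivProdArrow _ _ _).symm
  have : tensorMap M N = E.toLinearMap := by
    refine Module.Basis.ext ((Basis.piTensorProduct bM).tensorProduct (Basis.piTensorProduct bN))
      fun p => ?_
    rw [LinearEquiv.coe_coe, Module.Basis.equiv_apply, Module.Basis.tensorProduct_apply,
      Basis.piTensorProduct_apply, Basis.piTensorProduct_apply, Basis.piTensorProduct_apply,
      tensorMap_tmul]
    exact congrArg _ (funext fun i => ((bM i).tensorProduct_apply (bN i) _ _).symm)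
  rw [this]
  exact E.bijective

end Mul

section Sigma

variable {J : Type*} {ι : J → Type*} (N : (Σ j, ι j) → Type*) [∀ p, AddCommGroup (N p)]
  [∀ p, Module K (N p)]

variable {N} in
-- This is what makes the iterated pure tensor multilinear: changing the entry at `(j, k)` affects
-- only the outer factor at `j`, and there only the inner entry at `k`.
theorem tprod_tprod_update [DecidableEq J] [∀ j, DecidableEq (ι j)] [DecidableEq (Σ j, ι j)]
    (e : ∀ p : Σ j, ι j, N p) (j : J) (k : ι j) (v : N ⟨j, k⟩) :
    (fun j' => tprod K fun k' => Function.update e ⟨j, k⟩ v ⟨j', k'⟩) =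
      Function.update (fun j' => tprod K fun k' => e ⟨j', k'⟩) j
        (tprod K (Function.update (fun k' => e ⟨j, k'⟩) k v)) := by
  funext j'
  by_cases hj : j' = j
  · subst hj
    rw [Function.update_self]
    congr 1
    funext k'
    by_cases hk : k' = k
    · subst hk; simp
    · rw [Function.update_of_ne hk, Function.update_of_ne]
      intro h; simp at h; exact hk h
  · rw [Function.update_of_ne hj]
    congr 1
    funext k'
    rw [Function.update_of_ne]
    intro h; exact hj (congrArg Sigma.fst h)

/-- The canonical map `⨂_{(j, k)} N ⟨j, k⟩ → ⨂_j ⨂_k N ⟨j, k⟩`. -/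
noncomputable def sigmaMap :
    (⨂[K] p : Σ j, ι j, N p) →ₗ[K] ⨂[K] j, ⨂[K] k, N ⟨j, k⟩ :=
  lift
    { toFun := fun e => tprod K fun j => tprod K fun k => e ⟨j, k⟩
      map_update_add' := fun e p x y => by
        classical
        obtain ⟨j, k⟩ := p
        simp only [tprod_tprod_update, MultilinearMap.map_update_add]
      map_update_smul' := fun e p c x => by
        classical
        obtain ⟨j, k⟩ := p
        simp only [tprod_tprod_update, MultilinearMap.map_update_smul] }

theorem sigmaMap_tprod (e : ∀ p : Σ j, ι j, N p) :
    sigmaMap N (tprod K e) = tprod K fun j => tprod K fun k => e ⟨j, k⟩ :=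
  lift.tprod _

/-- Again bases of pure tensors correspond, now through currying of the basis indices. -/
theorem sigmaMap_bijective [Finite J] [∀ j, Finite (ι j)] :
    Function.Bijective (sigmaMap (K := K) N) := by
  let b := fun (p : Σ j, ι j) => Module.Basis.ofVectorSpace K (N p)
  let E := (Basis.piTensorProduct b).equiv
    (Basis.piTensorProduct fun j => Basis.piTensorProduct fun k => b ⟨j, k⟩)
    (Equiv.piCurry fun j k => Module.Basis.ofVectorSpaceIndex K (N ⟨j, k⟩))
  have : sigmaMap N = E.toLinearMap := by
    refine Module.Basis.ext (Basis.piTensorProduct b) fun p => ?_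
    rw [LinearEquiv.coe_coe, Module.Basis.equiv_apply,
      Basis.piTensorProduct_apply, Basis.piTensorProduct_apply, sigmaMap_tprod]
    exact congrArg _ (funext fun i => (Basis.piTensorProduct_apply _ _).symm)
  rw [this]
  exact E.bijective

/-- Associativity of tensor products over a family of index sets. -/
noncomputable def sigmaEquiv [Finite J] [∀ j, Finite (ι j)] {I : Type*} (M : I → Type*)
    [∀ i, AddCommGroup (M i)] [∀ i, Module K (M i)] (σ : (Σ j, ι j) ≃ I) :
    (⨂[K] i, M i) ≃ₗ[K] ⨂[K] j, ⨂[K] k : ι j, M (σ ⟨j, k⟩) :=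
  pullEquiv M σ ≪≫ₗ LinearEquiv.ofBijective _ (sigmaMap_bijective fun p => M (σ p))

theorem sigmaEquiv_tprod [Finite J] [∀ j, Finite (ι j)] {I : Type*} (M : I → Type*)
    [∀ i, AddCommGroup (M i)] [∀ i, Module K (M i)] (σ : (Σ j, ι j) ≃ I) (e : ∀ i, M i) :
    sigmaEquiv M σ (tprod K e) = tprod K fun j => tprod K fun k => e (σ ⟨j, k⟩) := by
  rw [sigmaEquiv, LinearEquiv.trans_apply, pullEquiv_tprod]
  exact sigmaMap_tprod (fun p => M (σ p)) _

end Sigma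

section Distrib

variable {I : Type*} [Finite I] {κ : I → Type*} [∀ i, Finite (κ i)] (M : ∀ i, κ i → Type*)
  [∀ i j, AddCommGroup (M i j)] [∀ i j, Module K (M i j)]

/-- Tensor products distribute over finite products. -/
theorem exists_distribEquiv : ∃ E : (⨂[K] i, ∀ j, M i j) ≃ₗ[K] ∀ p : ∀ i, κ i, ⨂[K] i, M i (p i),
    ∀ e p, E (tprod K e) p = tprod K fun i => e i (p i) := by
  classical
  have := Fintype.ofFinite I
  have := fun i => Fintype.ofFinite (κ i)
  -- The inner products are finite, hence direct sums, over which the tensor product distributes.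
  refine ⟨PiTensorProduct.congr (fun i => (DFinsupp.linearEquivFunOnFintype (R := K)).symm) ≪≫ₗ
    ofDFinsuppEquiv ≪≫ₗ DFinsupp.linearEquivFunOnFintype, fun e p => ?_⟩
  simp only [LinearEquiv.trans_apply, congr_tprod]
  exact ofDFinsuppEquiv_tprod_apply _ _

end Distrib

end PiTensorProduct

/-! ### Disjoint unions and fibres of maps of finite `G`-sets. -/

namespace FinGSet

variable {G : Type u} [Group G]

/-- The empty `G`-set. -/
def empty (G : Type u) [Group G] : FinGSet G where
  carrier := PEmpty
  action :=
    { smul := fun _ x => x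
      one_smul := fun x => x.elim
      mul_smul := fun _ _ x => x.elim }

instance : IsEmpty (empty G) := inferInstanceAs (IsEmpty PEmpty)

/-- The map from the empty `G`-set. -/
def fromEmpty (X : FinGSet G) : empty G →[G] X where
  toFun x := isEmptyElim x
  map_smul' _ x := isEmptyElim x

/-- Base change along this square says that restriction after induction along an injection is the
identity. -/
theorem isPullbackSquare_of_injective {X Y : FinGSet G} (i : X →[G] Y)
    (hi : Function.Injective i) :
    IsPullbackSquare (MulActionHom.id G) (MulActionHom.id G) i i :=
  ⟨fun _ => rfl, fun _ _ h => congrArg (fun q => q.1.1) h, fun q =>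
    ⟨q.1.1, Subtype.ext (Prod.ext rfl (hi q.2))⟩⟩

/-- Base change along this square factors through the value at the empty set, so restriction after
induction is trivial for disjoint images. -/
theorem isPullbackSquare_empty {X Y Z : FinGSet G} (i : X →[G] Z) (j : Y →[G] Z)
    (h : ∀ x y, i x ≠ j y) : IsPullbackSquare (fromEmpty X) (fromEmpty Y) i j :=
  ⟨fun z => isEmptyElim z, fun z => isEmptyElim z, fun q => (h _ _ q.2).elim⟩

theorem inl_injective (X Y : FinGSet G) : Function.Injective (inl X Y) :=
  Sum.inl_injective

theorem inr_injective (X Y : FinGSet G) : Function.Injective (inr X Y) :=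
  Sum.inr_injective

theorem inl_ne_inr {X Y : FinGSet G} (x : X) (y : Y) : inl X Y x ≠ inr X Y y :=
  Sum.inl_ne_inr

/-- Additivity on disjoint unions follows from base change once every element of `S (Ω ⊔ Ψ)` is
the sum of its two parts. -/
theorem disjUnion_bijective {S : FinGSet G → Type w} [∀ X, AddCommMonoid (S X)]
    (res : ∀ {X Y : FinGSet G}, (X →[G] Y) → S Y → S X)
    (push : ∀ {X Y : FinGSet G}, (X →[G] Y) → S X → S Y)
    (res_add : ∀ {X Y : FinGSet G} (f : X →[G] Y) (a b : S Y), res f (a + b) = res f a + res f b)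
    (push_zero : ∀ {X Y : FinGSet G} (f : X →[G] Y), push f 0 = 0)
    (res_id : ∀ {X : FinGSet G} (a : S X), res (MulActionHom.id G : X →[G] X) a = a)
    (push_id : ∀ {X : FinGSet G} (a : S X), push (MulActionHom.id G : X →[G] X) a = a)
    (base_change : ∀ {Ω₁ Ω₂ Ω₃ Ω₄ : FinGSet G} (α : Ω₁ →[G] Ω₂) (β : Ω₁ →[G] Ω₃)
      (γ : Ω₂ →[G] Ω₄) (δ : Ω₃ →[G] Ω₄), IsPullbackSquare α β γ δ →
      ∀ a : S Ω₂, res δ (push γ a) = push β (res α a))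
    (subsingleton : Subsingleton (S (empty G))) (Ω Ψ : FinGSet G)
    (split : ∀ c : S (disjUnion Ω Ψ),
      push (inl Ω Ψ) (res (inl Ω Ψ) c) + push (inr Ω Ψ) (res (inr Ω Ψ) c) = c) :
    Function.Bijective (fun c : S Ω × S Ψ => push (inl Ω Ψ) c.1 + push (inr Ω Ψ) c.2) := by
  -- Restriction along an inclusion undoes induction along it (`hi`) and kills induction along the
  -- other one (`hn`), so the two restrictions together form the inverse.
  have hi {X Y : FinGSet G} (i : X →[G] Y) (hi : Function.Injective i) (a : S X) :
      res i (push i a) = a := by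
    rw [base_change _ _ _ _ (isPullbackSquare_of_injective i hi), res_id, push_id]
  have hn {X Y Z : FinGSet G} (i : X →[G] Z) (j : Y →[G] Z) (h : ∀ x y, i x ≠ j y) (a : S X) :
      res j (push i a) = 0 := by
    rw [base_change _ _ _ _ (isPullbackSquare_empty i j h), Subsingleton.elim (res _ a) 0,
      push_zero]
  refine Function.bijective_iff_has_inverse.2
    ⟨fun c => (res (inl Ω Ψ) c, res (inr Ω Ψ) c), fun c => ?_, split⟩
  ext
  · simp only [res_add]
    rw [hi _ (inl_injective _ _), hn _ _ fun x y => (inl_ne_inr y x).symm, add_zero]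
  · simp only [res_add]
    rw [hi _ (inr_injective _ _), hn _ _ fun x y => inl_ne_inr x y, zero_add]

/-- The fibre of the identity of `X ⊔ Y` is the disjoint union of the fibres of the inclusions. -/
noncomputable def fibreSumEquiv {X Y : FinGSet G} (t : disjUnion X Y) :
    {x : X // inl X Y x = t} ⊕ {y : Y // inr X Y y = t} ≃
      {s : disjUnion X Y // MulActionHom.id G s = t} :=
  Equiv.ofBijective
    (Sum.elim (fun x => ⟨inl X Y x.1, x.2⟩) (fun y => ⟨inr X Y y.1, y.2⟩)) <| by
    constructor
    · rintro (⟨x, rfl⟩ | ⟨y, rfl⟩) (⟨x', h'⟩ | ⟨y', h'⟩) h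
      · obtain rfl := inl_injective X Y h'; rfl
      · exact (inl_ne_inr _ _ h'.symm).elim
      · exact (inl_ne_inr _ _ h').elim
      · obtain rfl := inr_injective X Y h'; rfl
    · rintro ⟨x | y, h⟩
      · exact ⟨Sum.inl ⟨x, h⟩, rfl⟩
      · exact ⟨Sum.inr ⟨y, h⟩, rfl⟩

/-- The fibres of a composition. -/
def fibreSigmaEquiv {X Y Z : FinGSet G} (g : Y →[G] Z) (f : X →[G] Y) (z : Z) :
    (Σ y : {y : Y // g y = z}, {x : X // f x = y.1}) ≃ {x : X // g.comp f x = z} where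
  toFun p := ⟨p.2.1, (congrArg g p.2.2).trans p.1.2⟩
  invFun x := ⟨⟨f x.1, x.2⟩, ⟨x.1, rfl⟩⟩
  left_inv := fun ⟨⟨_, _⟩, ⟨_, h⟩⟩ => by cases h; rfl
  right_inv _ := rfl

/-- The bijection of the fibres in a pullback square. -/
noncomputable def IsPullbackSquare.fibreEquiv {Ω₁ Ω₂ Ω₃ Ω₄ : FinGSet G} {α : Ω₁ →[G] Ω₂}
    {β : Ω₁ →[G] Ω₃} {γ : Ω₂ →[G] Ω₄} {δ : Ω₃ →[G] Ω₄} (h : IsPullbackSquare α β γ δ) (w : Ω₃) :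
    {z : Ω₁ // β z = w} ≃ {x : Ω₂ // γ x = δ w} :=
  Equiv.ofBijective (fun z => ⟨α z.1, (h.1 z.1).trans (congrArg δ z.2)⟩) <| by
    obtain ⟨comm, inj, surj⟩ := h
    constructor
    · rintro ⟨z, hz⟩ ⟨z', hz'⟩ h
      exact Subtype.ext (inj (Subtype.ext (Prod.ext (congrArg Subtype.val h) (hz.trans hz'.symm))))
    · rintro ⟨x, hx⟩
      obtain ⟨z, hz⟩ := surj ⟨(x, w), hx⟩
      exact ⟨⟨z, congrArg (fun q => q.1.2) hz⟩, Subtype.ext (congrArg (fun q => q.1.1) hz)⟩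

end FinGSet

/-! ### Canonical isomorphisms for induction and tensor induction. -/

namespace GBundle

variable {K : Type u} [Field K] {G : Type u} [Group G] {X Y Z : FinGSet G}

/-- The definition evaluates the family at `g⁻¹ • x'`, which in practice equals the wanted point
only propositionally. Here any `x` with `g • x = x'` may be used, without casts. -/
theorem moveFamily_apply (V : GBundle K X) (f : X →[G] Y) {g : G} {y y' : Y} (h : g • y = y')
    (e : ∀ x : {x : X // f x = y}, V.fib x.1) (x : {x : X // f x = y}) (x' : {x : X // f x = y'})
    (hx : g • x.1 = x'.1) : V.moveFamily f g h e x' = V.map g hx (e x) :=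
  V.map_congr (j := fun x : {x : X // f x = y} => x.1) e rfl
    (a := (FinGSet.fibreEquiv f g h).symm x') (b := x)
    (Subtype.ext ((congrArg (g⁻¹ • ·) hx.symm).trans (inv_smul_smul g x.1))) _ hx

/-- The identification of the fibres at equal points. -/
def fibCast (V : GBundle K X) {a b : X} (h : a = b) : V.fib a ≃ₗ[K] V.fib b :=
  h ▸ LinearEquiv.refl K _

/-- On the values of a dependent family a cast is just a change of index, so it disappears. -/
theorem fibCast_apply (V : GBundle K X) {ι : Type*} {j : ι → X} (m : ∀ i, V.fib (j i)) {i i' : ι}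
    (h : i = i') (h' : j i = j i') : V.fibCast h' (m i) = m i' := by
  subst h
  rfl

theorem norm_map_tprod (V : GBundle K X) (f : X →[G] Y) (g : G) {y y' : Y} (h : g • y = y')
    (e : ∀ x : {x : X // f x = y}, V.fib x.1) :
    (V.norm f).map g h (PiTensorProduct.tprod K e) =
      PiTensorProduct.tprod K (V.moveFamily f g h e) :=
  V.normMap_tprod f g h e

/-- An isomorphism out of a tensor induction is determined on pure tensors. -/
def isoOfNorm (V : GBundle K X) (f : X →[G] Y) (W : GBundle K Y)
    (E : ∀ y, (⨂[K] x : {x : X // f x = y}, V.fib x.1) ≃ₗ[K] W.fib y)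
    (F : ∀ y, (∀ x : {x : X // f x = y}, V.fib x.1) → W.fib y)
    (hF : ∀ y e, E y (PiTensorProduct.tprod K e) = F y e)
    (hE : ∀ (g : G) {y y' : Y} (h : g • y = y') (e : ∀ x : {x : X // f x = y}, V.fib x.1),
      F y' (V.moveFamily f g h e) = W.map g h (F y e)) : Iso (V.norm f) W where
  equiv := E
  comm g y y' h v := by
    have H : (E y').toLinearMap ∘ₗ V.normMap f g h = W.map g h ∘ₗ (E y).toLinearMap := by
      refine PiTensorProduct.ext (MultilinearMap.ext fun e => ?_)
      simp only [LinearMap.compMultilinearMap_apply, LinearMap.comp_apply, LinearEquiv.coe_coe,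
        normMap_tprod, hF, hE]
    exact LinearMap.congr_fun H v

/-- Pulling back the factors of a product along a bijection of the index sets. -/
def piPull {I J : Type*} (M : I → Type*) [∀ i, AddCommGroup (M i)]
    [∀ i, Module K (M i)] (σ : J ≃ I) : (∀ i, M i) ≃ₗ[K] ∀ j, M (σ j) :=
  LinearEquiv.piCongrLeft' K M σ.symm

section Induction

/-- Induction is additive. -/
def indAdd (f : X →[G] Y) (V W : GBundle K X) :
    Iso ((V.add W).ind f) ((V.ind f).add (W.ind f)) where
  equiv _ :=
    { toFun := fun e => (fun x => (e x).1, fun x => (e x).2)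
      invFun := fun e x => (e.1 x, e.2 x)
      map_add' := fun _ _ => rfl
      map_smul' := fun _ _ => rfl
      left_inv := fun _ => rfl
      right_inv := fun _ => rfl }
  comm _ _ _ _ _ := rfl

/-- Induction preserves the zero bundle. -/
def indZero (f : X →[G] Y) : Iso ((zero K X).ind f) (zero K Y) where
  equiv _ :=
    { toFun := fun _ => PUnit.unit
      invFun := fun _ _ => PUnit.unit
      map_add' := fun _ _ => rfl
      map_smul' := fun _ _ => rfl
      left_inv := fun _ => rfl
      right_inv := fun _ => rfl }
  comm _ _ _ _ _ := rfl

/-- Induction along the identity. -/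
noncomputable def indId (V : GBundle K X) : Iso (V.ind (MulActionHom.id G)) V where
  equiv y := LinearEquiv.ofBijective
    (LinearMap.proj (R := K) (φ := fun x : {x : X // MulActionHom.id G x = y} => V.fib x.1)
      ⟨y, rfl⟩)
    ⟨fun e e' h => funext fun ⟨_, hx⟩ => by cases hx; exact h,
      fun v => ⟨fun x => V.fibCast x.2.symm v, rfl⟩⟩
  comm g x y h v := V.moveFamily_apply (MulActionHom.id G) h v ⟨x, rfl⟩ ⟨y, rfl⟩ h

/-- Induction along a composition. -/
def indComp (g : Y →[G] Z) (f : X →[G] Y) (V : GBundle K X) :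
    Iso (V.ind (g.comp f)) ((V.ind f).ind g) where
  equiv z := piPull (K := K) (fun x : {x : X // g.comp f x = z} => V.fib x.1)
      (FinGSet.fibreSigmaEquiv g f z) ≪≫ₗ
    LinearEquiv.piCurry K fun (y : {y : Y // g y = z}) (x : {x : X // f x = y.1}) => V.fib x.1
  comm _ _ _ _ _ := rfl

/-- Base change for induction. -/
noncomputable def indBaseChange {Ω₁ Ω₂ Ω₃ Ω₄ : FinGSet G} {α : Ω₁ →[G] Ω₂}
    {β : Ω₁ →[G] Ω₃} {γ : Ω₂ →[G] Ω₄} {δ : Ω₃ →[G] Ω₄} (h : FinGSet.IsPullbackSquare α β γ δ)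
    (V : GBundle K Ω₂) : Iso ((V.ind γ).res δ) ((V.res α).ind β) where
  equiv w := piPull (K := K) (fun x : {x : Ω₂ // γ x = δ w} => V.fib x.1) (h.fibreEquiv w)
  comm g w w' hw v := by
    funext z
    exact moveFamily_apply V γ _ v (h.fibreEquiv w ((FinGSet.fibreEquiv β g hw).symm z))
      (h.fibreEquiv w' z) _

/-- A bundle over a disjoint union is the sum of its two parts. -/
noncomputable def indSplit (V : GBundle K (FinGSet.disjUnion X Y)) :
    Iso (V.ind (MulActionHom.id G)) (((V.res (FinGSet.inl X Y)).ind (FinGSet.inl X Y)).add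
      ((V.res (FinGSet.inr X Y)).ind (FinGSet.inr X Y))) where
  equiv t := piPull (K := K)
      (fun s : {s : FinGSet.disjUnion X Y // MulActionHom.id G s = t} => V.fib s.1)
      (FinGSet.fibreSumEquiv t) ≪≫ₗ LinearEquiv.sumPiEquivProdPi K _ _ _
  comm _ _ _ _ _ := rfl

end Induction

section Norm

/-- Tensor induction is multiplicative. -/
noncomputable def normMul (f : X →[G] Y) (V W : GBundle K X) :
    Iso ((V.norm f).mul (W.norm f)) ((V.mul W).norm f) where
  equiv y := LinearEquiv.ofBijective _
    (PiTensorProduct.tensorMap_bijective (K := K) (fun x : {x : X // f x = y} => V.fib x.1)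
      (fun x : {x : X // f x = y} => W.fib x.1))
  comm g y y' h v := by
    have H : PiTensorProduct.tensorMap (K := K) (fun x : {x : X // f x = y'} => V.fib x.1)
          (fun x : {x : X // f x = y'} => W.fib x.1) ∘ₗ
        TensorProduct.map (V.normMap f g h) (W.normMap f g h) =
        (V.mul W).normMap f g h ∘ₗ
          PiTensorProduct.tensorMap (K := K) (fun x : {x : X // f x = y} => V.fib x.1)
          (fun x : {x : X // f x = y} => W.fib x.1) := by
      refine TensorProduct.ext (PiTensorProduct.ext (MultilinearMap.ext fun a =>
        PiTensorProduct.ext (MultilinearMap.ext fun b => ?_)))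
      change PiTensorProduct.tensorMap _ _ (V.normMap f g h (PiTensorProduct.tprod K a) ⊗ₜ
          W.normMap f g h (PiTensorProduct.tprod K b)) = (V.mul W).normMap f g h
          (PiTensorProduct.tensorMap _ _ (PiTensorProduct.tprod K a ⊗ₜ PiTensorProduct.tprod K b))
      rw [normMap_tprod, normMap_tprod, PiTensorProduct.tensorMap_tmul,
        PiTensorProduct.tensorMap_tmul]
      exact ((V.mul W).normMap_tprod f g h fun i => a i ⊗ₜ b i).symm
    exact LinearMap.congr_fun H v

/-- Tensor induction preserves the trivial line bundle. -/
noncomputable def normOne (f : X →[G] Y) : Iso ((one K X).norm f) (one K Y) :=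
  haveI (y : Y) : Fintype {x : X // f x = y} := Fintype.ofFinite _
  isoOfNorm _ f _
    (fun y => (PiTensorProduct.constantBaseRingEquiv {x : X // f x = y} K).toLinearEquiv)
    (fun y (e : {x : X // f x = y} → K) => Finset.prod (M := K) Finset.univ e)
    (fun _ e => PiTensorProduct.constantBaseRingEquiv_tprod e)
    -- The trivial line bundle has identity transition maps, so equivariance is invariance of a
    -- finite product under reindexing.
    fun g _ _ h _ => Fintype.prod_equiv (M := K) (FinGSet.fibreEquiv f g h).symm _ _ fun _ => rfl

/-- Tensor induction along the identity. -/
noncomputable def normId (V : GBundle K X) : Iso (V.norm (MulActionHom.id G)) V :=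
  haveI (y : X) : Subsingleton {x : X // MulActionHom.id G x = y} :=
    ⟨fun a b => Subtype.ext (a.2.trans b.2.symm)⟩
  isoOfNorm _ _ _ (fun y => PiTensorProduct.subsingletonEquiv (R := K)
      (s := fun x : {x : X // MulActionHom.id G x = y} => V.fib x.1) ⟨y, rfl⟩)
    (fun y e => e ⟨y, rfl⟩)
    (fun _ e => PiTensorProduct.subsingletonEquiv_apply_tprod _ e)
    fun _ y y' h e => V.moveFamily_apply (MulActionHom.id G) h e ⟨y, rfl⟩ ⟨y', rfl⟩ h

/-- Tensor induction along a composition. -/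
noncomputable def normComp (g : Y →[G] Z) (f : X →[G] Y) (V : GBundle K X) :
    Iso (V.norm (g.comp f)) ((V.norm f).norm g) :=
  isoOfNorm _ _ _ (fun z => PiTensorProduct.sigmaEquiv
      (fun x : {x : X // g.comp f x = z} => V.fib x.1) (FinGSet.fibreSigmaEquiv g f z))
    (fun z e => PiTensorProduct.tprod K fun y : {y : Y // g y = z} =>
      PiTensorProduct.tprod K fun x : {x : X // f x = y.1} =>
        e (FinGSet.fibreSigmaEquiv g f z ⟨y, x⟩))
    (fun z e => PiTensorProduct.sigmaEquiv_tprod _ _ e)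
    fun a z z' h e => by
      have H := norm_map_tprod (V.norm f) g a h fun y : {y : Y // g y = z} =>
        PiTensorProduct.tprod K fun x : {x : X // f x = y.1} =>
          e (FinGSet.fibreSigmaEquiv g f z ⟨y, x⟩)
      refine Eq.trans ?_ H.symm
      refine congrArg (PiTensorProduct.tprod K) (funext fun y => ?_)
      exact (norm_map_tprod V f a _ fun x => e (FinGSet.fibreSigmaEquiv g f z ⟨_, x⟩)).symm

/-- Base change for tensor induction. -/
noncomputable def normBaseChange {Ω₁ Ω₂ Ω₃ Ω₄ : FinGSet G} {α : Ω₁ →[G] Ω₂}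
    {β : Ω₁ →[G] Ω₃} {γ : Ω₂ →[G] Ω₄} {δ : Ω₃ →[G] Ω₄} (h : FinGSet.IsPullbackSquare α β γ δ)
    (V : GBundle K Ω₂) : Iso ((V.norm γ).res δ) ((V.res α).norm β) where
  equiv w := PiTensorProduct.pullEquiv (K := K) (fun x : {x : Ω₂ // γ x = δ w} => V.fib x.1)
    (h.fibreEquiv w)
  comm g w w' hw v := by
    have hw' : g • δ w = δ w' := by rw [← map_smul, hw]
    have H : (PiTensorProduct.pullEquiv (K := K) (fun x : {x : Ω₂ // γ x = δ w'} => V.fib x.1)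
          (h.fibreEquiv w')).toLinearMap ∘ₗ V.normMap γ g hw' =
        (V.res α).normMap β g hw ∘ₗ
          (PiTensorProduct.pullEquiv (K := K) (fun x : {x : Ω₂ // γ x = δ w} => V.fib x.1)
            (h.fibreEquiv w)).toLinearMap := by
      refine PiTensorProduct.ext (MultilinearMap.ext fun e => ?_)
      change PiTensorProduct.pullEquiv (fun x : {x : Ω₂ // γ x = δ w'} => V.fib x.1)
          (h.fibreEquiv w') (V.normMap γ g hw' (PiTensorProduct.tprod K e)) =
        (V.res α).normMap β g hw (PiTensorProduct.pullEquiv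
          (fun x : {x : Ω₂ // γ x = δ w} => V.fib x.1) (h.fibreEquiv w)
          (PiTensorProduct.tprod K e))
      rw [normMap_tprod, PiTensorProduct.pullEquiv_tprod, PiTensorProduct.pullEquiv_tprod]
      refine Eq.trans ?_ ((V.res α).normMap_tprod β g hw fun z => e (h.fibreEquiv w z)).symm
      exact congrArg _ (funext fun z => moveFamily_apply V γ _ e
        (h.fibreEquiv w ((FinGSet.fibreEquiv β g hw).symm z)) (h.fibreEquiv w' z) _)
    exact LinearMap.congr_fun H v

/-- A bundle over a disjoint union is the product of the tensor inductions of its two parts. -/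
noncomputable def normSplit (V : GBundle K (FinGSet.disjUnion X Y)) :
    Iso (V.norm (MulActionHom.id G)) (((V.res (FinGSet.inl X Y)).norm (FinGSet.inl X Y)).mul
      ((V.res (FinGSet.inr X Y)).norm (FinGSet.inr X Y))) :=
  isoOfNorm _ _ _ (fun t => PiTensorProduct.pullEquiv (K := K)
      (fun s : {s : FinGSet.disjUnion X Y // MulActionHom.id G s = t} => V.fib s.1)
      (FinGSet.fibreSumEquiv t) ≪≫ₗ (PiTensorProduct.tmulEquivDep K _).symm)
    (fun t e => (PiTensorProduct.tprod K fun x : {x : X // FinGSet.inl X Y x = t} =>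
        e (FinGSet.fibreSumEquiv t (Sum.inl x))) ⊗ₜ[K]
      (PiTensorProduct.tprod K fun x : {y : Y // FinGSet.inr X Y y = t} =>
        e (FinGSet.fibreSumEquiv t (Sum.inr x))))
    (fun t e => by
      change (PiTensorProduct.tmulEquivDep K _).symm (PiTensorProduct.pullEquiv (K := K)
        (fun s : {s : FinGSet.disjUnion X Y // MulActionHom.id G s = t} => V.fib s.1)
        (FinGSet.fibreSumEquiv t) (PiTensorProduct.tprod K e)) = _
      rw [PiTensorProduct.pullEquiv_tprod]
      exact PiTensorProduct.tmulEquivDep_symm_apply K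
        (fun j => V.fib (FinGSet.fibreSumEquiv t j).1) fun j => e (FinGSet.fibreSumEquiv t j))
    fun g t t' h e => by
      have hl := norm_map_tprod (V.res (FinGSet.inl X Y)) (FinGSet.inl X Y) g h fun x =>
        e (FinGSet.fibreSumEquiv t (Sum.inl x))
      have hr := norm_map_tprod (V.res (FinGSet.inr X Y)) (FinGSet.inr X Y) g h fun x =>
        e (FinGSet.fibreSumEquiv t (Sum.inr x))
      exact (congrArg₂ (· ⊗ₜ[K] ·) hl hr).symm

end Norm

end GBundle

/-! ### Exponential diagrams and distributivity. -/

namespace FinGSet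

variable {G : Type u} [Group G] {X' Z X Y' Y : FinGSet G} {e : X' →[G] Z} {p : Z →[G] X}
  {f : X →[G] Y} {f' : X' →[G] Y'} {q : Y' →[G] Y}

/-- In an exponential diagram the outer square is a pullback. -/
theorem IsExponential.isPullbackSquare (h : IsExponential e p f f' q) :
    IsPullbackSquare (p.comp e) f' f q := by
  obtain ⟨a, b, ha, hb, he, hf, hq⟩ := h
  have hp (x : X') : p (e x) = (a x).1.1 := by
    rw [← he]; exact (a x).1.2.2.2 _
  have hf' (x : X') : b (f' x) = (a x).1.2 := (hf x).symm
  refine ⟨fun x => ?_, fun x x' h => ha.1 (Subtype.ext (Prod.ext ?_ ?_)), fun ⟨⟨x, y⟩, hxy⟩ => ?_⟩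
  · change f (p (e x)) = q (f' x)
    rw [hp, ← hq, hf']
    exact (a x).2
  · rw [← hp, ← hp]
    exact congrArg (fun t => t.1.1) h
  · rw [← hf', ← hf']
    exact congrArg (fun t => b t.1.2) h
  · obtain ⟨x', hx'⟩ := ha.2 ⟨(x, b y), hxy.trans (hq y).symm⟩
    refine ⟨x', Subtype.ext (Prod.ext ?_ (hb.1 ?_))⟩
    · change p (e x') = x
      rw [hp, hx']
    · change b (f' x') = b y
      rw [hf', hx']

/-- The section and the point are variables here, so both can be replaced by equal ones despite the
dependent types. -/
theorem piEval_eq {A X Y : FinGSet G} {p : A →[G] X} {f : X →[G] Y}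
    (z : fibreProduct f (piProj p f)) (w : PiSections p f) (hw : z.1.2 = w) (x : X)
    (hx : z.1.1 = x) (h : f x = w.1) : piEval p f z = w.2.1 ⟨x, h⟩ := by
  subst hw hx
  rfl

/-- In an exponential diagram, the points of `Y'` over `y` are the sections over `f⁻¹(y)`. -/
noncomputable def IsExponential.sectionsEquiv (h : IsExponential e p f f' q) (y : Y) :
    {b : Y' // q b = y} ≃ ∀ x : {x : X // f x = y}, {z : Z // p z = x.1} :=
  Equiv.ofBijective (fun b x =>
    -- By the pullback property exactly one point of `X'` lies over both `x` and `b`.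
    let x' := (h.isPullbackSquare.fibreEquiv b.1).symm ⟨x.1, x.2.trans b.2.symm⟩
    ⟨e x'.1, congrArg Subtype.val (Equiv.apply_symm_apply (h.isPullbackSquare.fibreEquiv b.1)
      ⟨x.1, x.2.trans b.2.symm⟩)⟩) <| by
    have hsq := h.isPullbackSquare
    obtain ⟨a, b, ha, hb, he, hf, hq⟩ := id h
    have hp (x : X') : p (e x) = (a x).1.1 := by
      rw [← he]; exact (a x).1.2.2.2 _
    -- The section read off from the pullback square is the one that `b β` carries as a point of
    -- `Π_f Z`; bijectivity then reduces to that of `b`.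
    have key (β : Y') (x : X) (hx : f x = q β) (hx' : f x = (b β).1) :
        e ((h.isPullbackSquare.fibreEquiv β).symm ⟨x, hx⟩).1 = (b β).2.1 ⟨x, hx'⟩ := by
      have h₁ := congrArg Subtype.val
        (Equiv.apply_symm_apply (h.isPullbackSquare.fibreEquiv β) ⟨x, hx⟩)
      generalize (h.isPullbackSquare.fibreEquiv β).symm ⟨x, hx⟩ = x' at h₁ ⊢
      rw [← he]
      exact piEval_eq _ _ ((hf x'.1).trans (congrArg b x'.2)) _ ((hp x'.1).symm.trans h₁) _
    constructor
    · rintro ⟨β, rfl⟩ ⟨β', h'⟩ H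
      refine Subtype.ext (hb.1 (PiSections.ext' ((hq β).trans (h'.symm.trans (hq β').symm))
        fun x hx hx' => ?_))
      have hx'' : f x = q β := hx.trans (hq β)
      rw [← key β x hx'', ← key β' x (hx''.trans h'.symm)]
      exact congrArg Subtype.val (congrFun H ⟨x, hx''⟩)
    · intro s
      obtain ⟨β, hβ⟩ := hb.2 (⟨y, fun x => (s x).1, fun x => (s x).2⟩ : PiSections p f)
      have hy : q β = y := by rw [← hq, hβ]; rfl
      refine ⟨⟨β, hy⟩, funext fun x => Subtype.ext ?_⟩
      refine (key β x.1 _ (x.2.trans (by rw [hβ]))).trans ?_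
      have (w : PiSections p f) (hw : w = ⟨y, fun x => (s x).1, fun x => (s x).2⟩)
          (h : f x.1 = w.1) : w.2.1 ⟨x.1, h⟩ = (s x).1 := by
        subst hw
        rfl
      exact this _ hβ _

/-- The point of `X'` over a given pair is unique, so any such point computes the section. -/
theorem IsExponential.sectionsEquiv_apply (h : IsExponential e p f f' q) {y : Y}
    (b : {b : Y' // q b = y}) (x : {x : X // f x = y}) (x' : X') (hb : f' x' = b.1)
    (hx : p (e x') = x.1) : (h.sectionsEquiv y b x).1 = e x' := by
  change e ((h.isPullbackSquare.fibreEquiv b.1).symm _).1 = e x'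
  refine congrArg (fun t : {x' // f' x' = b.1} => e t.1) (a₂ := ⟨x', hb⟩) ?_
  rw [Equiv.symm_apply_eq]
  exact Subtype.ext hx.symm

end FinGSet

namespace GBundle

variable {K : Type u} [Field K] {G : Type u} [Group G] {X' Z X Y' Y : FinGSet G}
  {e : X' →[G] Z} {p : Z →[G] X} {f : X →[G] Y} {f' : X' →[G] Y'} {q : Y' →[G] Y}

/-- The point of `X` in the fibre over `y` below a point of `X'`. -/
def _root_.FinGSet.IsExponential.below (h : FinGSet.IsExponential e p f f' q) {y : Y}
    (b : {b : Y' // q b = y}) (x' : {x' : X' // f' x' = b.1}) : {x : X // f x = y} :=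
  ⟨p (e x'.1), (h.isPullbackSquare.1 x'.1).trans ((congrArg q x'.2).trans b.2)⟩

/-- Distributivity gives a sum over choice functions on `f⁻¹(y)`. These are the points `b` of `Y'`
over `y`, and for each of them the fibre of `f'` over `b` is in bijection with `f⁻¹(y)`. The formula
on pure tensors contains no casts, which makes equivariance easy to check. -/
theorem exists_expEquiv (h : FinGSet.IsExponential e p f f' q) (V : GBundle K Z) (y : Y) :
    ∃ E : (⨂[K] x : {x : X // f x = y}, ∀ z : {z : Z // p z = x.1}, V.fib z.1) ≃ₗ[K]
        ∀ b : {b : Y' // q b = y}, ⨂[K] x' : {x' : X' // f' x' = b.1}, V.fib (e x'.1),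
      ∀ m, E (PiTensorProduct.tprod K m) = fun b => PiTensorProduct.tprod K fun x' =>
        m (h.below b x') ⟨e x'.1, rfl⟩ := by
  obtain ⟨E, hE⟩ := PiTensorProduct.exists_distribEquiv (K := K)
    (fun (x : {x : X // f x = y}) (z : {z : Z // p z = x.1}) => V.fib z.1)
  let σ (b : {b : Y' // q b = y}) : {x' : X' // f' x' = b.1} ≃ {x : X // f x = y} :=
    (h.isPullbackSquare.fibreEquiv b.1).trans
      (Equiv.subtypeEquivRight fun x => by rw [b.2])
  -- This equality of points of `Z` is not definitional, hence the `fibCast` in the last factor of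
  -- the equivalence.
  have hσ (b : {b : Y' // q b = y}) (x') : (h.sectionsEquiv y b (σ b x')) = ⟨e x'.1, rfl⟩ :=
    Subtype.ext (h.sectionsEquiv_apply b (σ b x') x'.1 x'.2 rfl)
  refine ⟨E ≪≫ₗ piPull (K := K)
      (fun s : (∀ x : {x : X // f x = y}, {z : Z // p z = x.1}) => ⨂[K] x, V.fib (s x).1)
      (h.sectionsEquiv y) ≪≫ₗ LinearEquiv.piCongrRight fun b =>
        PiTensorProduct.pullEquiv (K := K)
          (fun x : {x : X // f x = y} => V.fib (h.sectionsEquiv y b x).1) (σ b) ≪≫ₗ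
        PiTensorProduct.congr fun x' =>
          V.fibCast (congrArg Subtype.val (hσ b x')), fun m => funext fun b => ?_⟩
  change PiTensorProduct.congr _ (PiTensorProduct.pullEquiv (K := K)
    (fun x : {x : X // f x = y} => V.fib (h.sectionsEquiv y b x).1) (σ b)
      (E (PiTensorProduct.tprod K m) (h.sectionsEquiv y b))) = _
  rw [hE, PiTensorProduct.pullEquiv_tprod, PiTensorProduct.congr_tprod]
  refine congrArg _ (funext fun x' => ?_)
  exact V.fibCast_apply (m (σ b x')) (hσ b x') _

/-- Distributivity of tensor induction over induction. -/
noncomputable def normInd (h : FinGSet.IsExponential e p f f' q) (V : GBundle K Z) :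
    Iso ((V.ind p).norm f) (((V.res e).norm f').ind q) :=
  isoOfNorm _ _ _ (fun y => (exists_expEquiv h V y).choose)
    (fun y m b => PiTensorProduct.tprod K fun x' : {x' : X' // f' x' = b.1} =>
        m (h.below b x') ⟨e x'.1, rfl⟩)
    (fun y m => (exists_expEquiv h V y).choose_spec m)
    fun g y y' hy m => by
      funext b
      have H := norm_map_tprod (V.res e) f' g (y := ((FinGSet.fibreEquiv q g hy).symm b).1)
        (smul_inv_smul g b.1) fun x' => m (h.below _ x') ⟨e x'.1, rfl⟩
      refine Eq.trans ?_ H.symm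
      refine congrArg _ (funext fun x' => ?_)
      -- The action is evaluated twice: first along `f` on the tensor factors, then along `p` inside
      -- one factor, each time at the point below `g⁻¹ • x'`.
      exact congrFun (moveFamily_apply (V.ind p) f hy m
        (h.below ((FinGSet.fibreEquiv q g hy).symm b)
          ((FinGSet.fibreEquiv f' g (smul_inv_smul g b.1)).symm x')) (h.below b x')
        ((map_smul (p.comp e) g _).symm.trans
          (congrArg (p.comp e) (smul_inv_smul g x'.1)))) ⟨e x'.1, rfl⟩ |>.trans
        (moveFamily_apply V p _ _ ⟨e (g⁻¹ • x'.1), rfl⟩ ⟨e x'.1, rfl⟩ _)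

end GBundle

/-! ### The semi-Tambara functor of isomorphism classes of bundles. -/

namespace KPlus

variable {K : Type u} [Field K] {G : Type u} [Group G] {X Y Z : FinGSet G}

instance [IsEmpty X] : Subsingleton (KPlus K X) where
  allEq := by
    rintro ⟨V⟩ ⟨W⟩
    exact mk_eq_mk ⟨fun x => isEmptyElim x, fun _ x => isEmptyElim x⟩

theorem isSemiMackey_tr : IsSemiMackey (fun X : FinGSet G => KPlus K X) (maps K G).res
    (maps K G).tr where
  res_zero _ := rfl
  res_add f := by rintro ⟨V⟩ ⟨W⟩; rfl
  push_zero f := mk_eq_mk (GBundle.indZero f)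
  push_add f := by rintro ⟨V⟩ ⟨W⟩; exact mk_eq_mk (GBundle.indAdd f V W)
  res_id := by rintro X ⟨V⟩; rfl
  res_comp g f := by rintro ⟨V⟩; rfl
  push_id := by rintro X ⟨V⟩; exact mk_eq_mk (GBundle.indId V)
  push_comp g f := by rintro ⟨V⟩; exact mk_eq_mk (GBundle.indComp g f V)
  base_change α β γ δ h := by rintro ⟨V⟩; exact mk_eq_mk (GBundle.indBaseChange h V)
  disjUnion Ω Ψ := by
    refine FinGSet.disjUnion_bijective (S := fun X : FinGSet G => KPlus K X) (maps K G).res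
      (maps K G).tr ?_ ?_ ?_ ?_ ?_ inferInstance Ω Ψ ?_
    · rintro X Y f ⟨V⟩ ⟨W⟩; rfl
    · exact fun f => mk_eq_mk (GBundle.indZero f)
    · rintro X ⟨V⟩; rfl
    · rintro X ⟨V⟩; exact mk_eq_mk (GBundle.indId V)
    · rintro _ _ _ _ α β γ δ h ⟨V⟩; exact mk_eq_mk (GBundle.indBaseChange h V)
    · rintro ⟨V⟩
      -- Induction along the identity is the intermediate step: its fibre over a point is the
      -- disjoint union of the fibres of the two inclusions.
      exact (mk_eq_mk (GBundle.indSplit V)).symm.trans (mk_eq_mk (GBundle.indId V))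

theorem isSemiMackey_nm : IsSemiMackey (fun X : FinGSet G => Additive (KPlus K X))
    (fun f a => Additive.ofMul ((maps K G).res f a.toMul))
    (fun f a => Additive.ofMul ((maps K G).nm f a.toMul)) where
  res_zero _ := rfl
  res_add f := by rintro ⟨V⟩ ⟨W⟩; rfl
  push_zero f := mk_eq_mk (GBundle.normOne f)
  push_add f := by rintro ⟨V⟩ ⟨W⟩; exact (mk_eq_mk (GBundle.normMul f V W)).symm
  res_id := by rintro X ⟨V⟩; rfl
  res_comp g f := by rintro ⟨V⟩; rfl
  push_id := by rintro X ⟨V⟩; exact mk_eq_mk (GBundle.normId V)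
  push_comp g f := by rintro ⟨V⟩; exact mk_eq_mk (GBundle.normComp g f V)
  base_change α β γ δ h := by rintro ⟨V⟩; exact mk_eq_mk (GBundle.normBaseChange h V)
  disjUnion Ω Ψ := by
    refine FinGSet.disjUnion_bijective (S := fun X : FinGSet G => Additive (KPlus K X))
      (fun f a => Additive.ofMul ((maps K G).res f a.toMul))
      (fun f a => Additive.ofMul ((maps K G).nm f a.toMul)) ?_ ?_ ?_ ?_ ?_
      (inferInstanceAs (Subsingleton (KPlus K _))) Ω Ψ ?_
    · rintro X Y f ⟨V⟩ ⟨W⟩; rfl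
    · exact fun f => mk_eq_mk (GBundle.normOne f)
    · rintro X ⟨V⟩; rfl
    · rintro X ⟨V⟩; exact mk_eq_mk (GBundle.normId V)
    · rintro _ _ _ _ α β γ δ h ⟨V⟩; exact mk_eq_mk (GBundle.normBaseChange h V)
    · rintro ⟨V⟩
      exact (mk_eq_mk (GBundle.normSplit V)).symm.trans (mk_eq_mk (GBundle.normId V))

/-- Isomorphism classes of vector bundles form a semi-Tambara functor. -/
theorem isSemiTambara_maps (K : Type u) [Field K] (G : Type u) [Group G] :
    IsSemiTambara (maps K G) where
  additive := isSemiMackey_tr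
  multiplicative := isSemiMackey_nm
  exponential e p f f' q h := by rintro ⟨V⟩; exact mk_eq_mk (GBundle.normInd h V)

end KPlus

/-! ### Consequences of the semi-Mackey and semi-Tambara axioms. -/

namespace FinGSet

variable {G : Type u} [Group G] {X Y Z : FinGSet G}

/-- The first projection of a fibre product. -/
def fibreFst (f : X →[G] Z) (g : Y →[G] Z) : fibreProduct f g →[G] X where
  toFun z := z.1.1
  map_smul' _ _ := rfl

/-- The second projection of a fibre product. -/
def fibreSnd (f : X →[G] Z) (g : Y →[G] Z) : fibreProduct f g →[G] Y where
  toFun z := z.1.2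
  map_smul' _ _ := rfl

theorem isPullbackSquare_fibreProduct (f : X →[G] Z) (g : Y →[G] Z) :
    IsPullbackSquare (fibreFst f g) (fibreSnd f g) f g :=
  ⟨fun z => z.2, fun _ _ h => Subtype.ext (congrArg Subtype.val h), fun q => ⟨q, rfl⟩⟩

theorem fibreFst_injective (f : X →[G] Z) (g : Y →[G] Z) (hg : Function.Injective g) :
    Function.Injective (fibreFst f g) := fun a b h =>
  Subtype.ext (Prod.ext h (hg (a.2.symm.trans ((congrArg f h).trans b.2))))

/-- The complement of the image of a `G`-map. -/
def compl (i : X →[G] Y) : FinGSet G where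
  carrier := {y : Y // ∀ x, i x ≠ y}
  action :=
    { smul := fun g y => ⟨g • y.1, fun x h => y.2 (g⁻¹ • x) (by rw [map_smul, h, inv_smul_smul])⟩
      one_smul := fun y => Subtype.ext (one_smul G y.1)
      mul_smul := fun a b y => Subtype.ext (mul_smul a b y.1) }

/-- The inclusion of the complement of an image. -/
def complIncl (i : X →[G] Y) : compl i →[G] Y where
  toFun y := y.1
  map_smul' _ _ := rfl

/-- The map out of a disjoint union with given components. -/
def sumElim (i : X →[G] Z) (j : Y →[G] Z) : disjUnion X Y →[G] Z where
  toFun t := Sum.elim i j t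
  map_smul' g t := by
    rcases t with x | y
    · exact map_smul i g x
    · exact map_smul j g y

theorem sumElim_bijective {i : X →[G] Z} {j : Y →[G] Z} (hi : Function.Injective i)
    (hj : Function.Injective j) (hd : ∀ x y, i x ≠ j y)
    (hc : ∀ z, (∃ x, i x = z) ∨ ∃ y, j y = z) : Function.Bijective (sumElim i j) :=
  ⟨Function.Injective.sumElim hi hj hd, fun z => (hc z).elim
    (fun ⟨x, h⟩ => ⟨(Sum.inl x : X ⊕ Y), h⟩) fun ⟨y, h⟩ => ⟨(Sum.inr y : X ⊕ Y), h⟩⟩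

/-- Base change along this square reads `push f (res f a) = a`. -/
theorem isPullbackSquare_of_bijective {f : X →[G] Y} (hf : Function.Bijective f) :
    IsPullbackSquare f f (MulActionHom.id G) (MulActionHom.id G) :=
  ⟨fun _ => rfl, fun _ _ h => hf.1 (congrArg (fun q => q.1.1) h), fun ⟨⟨y, y'⟩, h⟩ => by
    obtain rfl : y = y' := h
    obtain ⟨x, rfl⟩ := hf.2 y
    exact ⟨x, rfl⟩⟩

theorem isExponential_canonical (p : Z →[G] X) (f : X →[G] Y) :
    IsExponential (piEval p f) p f (piSnd p f) (piProj p f) :=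
  ⟨MulActionHom.id G, MulActionHom.id G, Function.bijective_id, Function.bijective_id,
    fun _ => rfl, fun _ => rfl, fun _ => rfl⟩

end FinGSet

namespace IsSemiMackey

variable {G : Type u} [Group G] {S : FinGSet G → Type w} [∀ X, AddCommMonoid (S X)]
  {res : ∀ {X Y : FinGSet G}, (X →[G] Y) → S Y → S X}
  {push : ∀ {X Y : FinGSet G}, (X →[G] Y) → S X → S Y} (hS : IsSemiMackey S res push)
  {X Y Z : FinGSet G}

include hS

/-- The two inclusions `X → X ⊔ X` coincide for empty `X`, so `(a, b)` and `(b, a)` have the same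
image under an injective map. -/
theorem subsingleton_of_isEmpty (X : FinGSet G) [IsEmpty X] : Subsingleton (S X) := by
  refine ⟨fun a b => ?_⟩
  have h : FinGSet.inl X X = FinGSet.inr X X := MulActionHom.ext fun x => isEmptyElim x
  refine congrArg Prod.fst (a₁ := (a, b)) (a₂ := (b, a)) ((hS.disjUnion X X).1 ?_)
  simp only [h]
  exact add_comm _ _

theorem res_push_of_injective (i : X →[G] Y) (hi : Function.Injective i) (a : S X) :
    res i (push i a) = a := by
  rw [hS.base_change _ _ _ _ (FinGSet.isPullbackSquare_of_injective i hi), hS.res_id, hS.push_id]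

theorem res_push_of_disjoint (i : X →[G] Z) (j : Y →[G] Z) (h : ∀ x y, i x ≠ j y) (a : S X) :
    res j (push i a) = 0 := by
  have := hS.subsingleton_of_isEmpty (FinGSet.empty G)
  rw [hS.base_change _ _ _ _ (FinGSet.isPullbackSquare_empty i j h), Subsingleton.elim (res _ a) 0,
    hS.push_zero]

theorem res_inl (a : S X) (b : S Y) :
    res (FinGSet.inl X Y) (push (FinGSet.inl X Y) a + push (FinGSet.inr X Y) b) = a := by
  rw [hS.res_add, hS.res_push_of_injective _ (FinGSet.inl_injective X Y),
    hS.res_push_of_disjoint _ _ fun x y => (FinGSet.inl_ne_inr y x).symm, add_zero]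

theorem res_inr (a : S X) (b : S Y) :
    res (FinGSet.inr X Y) (push (FinGSet.inl X Y) a + push (FinGSet.inr X Y) b) = b := by
  rw [hS.res_add, hS.res_push_of_injective _ (FinGSet.inr_injective X Y),
    hS.res_push_of_disjoint _ _ fun x y => FinGSet.inl_ne_inr x y, zero_add]

/-- The disjoint union axiom is transported along the bijection `sumElim i j` from `X ⊔ Y` to `Z`.
-/
theorem split {i : X →[G] Z} {j : Y →[G] Z} (hi : Function.Injective i)
    (hj : Function.Injective j) (hd : ∀ x y, i x ≠ j y)
    (hc : ∀ z, (∃ x, i x = z) ∨ ∃ y, j y = z) (c : S Z) :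
    push i (res i c) + push j (res j c) = c := by
  have h := hS.base_change _ _ _ _
    (FinGSet.isPullbackSquare_of_bijective (FinGSet.sumElim_bijective hi hj hd hc)) c
  rw [hS.res_id, hS.push_id] at h
  have hi' : i = (FinGSet.sumElim i j).comp (FinGSet.inl X Y) := rfl
  have hj' : j = (FinGSet.sumElim i j).comp (FinGSet.inr X Y) := rfl
  obtain ⟨⟨a, b⟩, hab⟩ := (hS.disjUnion X Y).2 (res (FinGSet.sumElim i j) c)
  have ha : res i c = a := by
    conv_lhs => rw [hi']
    rw [hS.res_comp, ← hab, hS.res_inl]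
  have hb : res j c = b := by
    conv_lhs => rw [hj']
    rw [hS.res_comp, ← hab, hS.res_inr]
  have hi'' : push i a = push (FinGSet.sumElim i j) (push (FinGSet.inl X Y) a) :=
    hS.push_comp (FinGSet.sumElim i j) (FinGSet.inl X Y) a
  have hj'' : push j b = push (FinGSet.sumElim i j) (push (FinGSet.inr X Y) b) :=
    hS.push_comp (FinGSet.sumElim i j) (FinGSet.inr X Y) b
  rw [ha, hb, hi'', hj'', ← hS.push_add]
  exact (congrArg _ hab).trans h.symm

theorem split_inl_inr (c : S (FinGSet.disjUnion X Y)) :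
    push (FinGSet.inl X Y) (res (FinGSet.inl X Y) c) +
      push (FinGSet.inr X Y) (res (FinGSet.inr X Y) c) = c :=
  hS.split (FinGSet.inl_injective X Y) (FinGSet.inr_injective X Y) FinGSet.inl_ne_inr
    (fun z => z.casesOn (fun x => .inl ⟨x, rfl⟩) fun y => .inr ⟨y, rfl⟩) c

end IsSemiMackey

namespace IsSemiTambara

variable {G : Type u} [Group G] {S : FinGSet G → Type w} [∀ X, CommSemiring (S X)]
  {T : TambaraMaps S} (hT : IsSemiTambara T) {X Y Z : FinGSet G}

include hT

theorem res_mul (f : X →[G] Y) (a b : S Y) : T.res f (a * b) = T.res f a * T.res f b :=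
  hT.multiplicative.res_add f (Additive.ofMul a) (Additive.ofMul b)

theorem res_one (f : X →[G] Y) : T.res f 1 = 1 := hT.multiplicative.res_zero f

theorem nm_mul (f : X →[G] Y) (a b : S X) : T.nm f (a * b) = T.nm f a * T.nm f b :=
  hT.multiplicative.push_add f (Additive.ofMul a) (Additive.ofMul b)

theorem nm_one (f : X →[G] Y) : T.nm f 1 = 1 := hT.multiplicative.push_zero f

theorem nm_id (a : S X) : T.nm (MulActionHom.id G : X →[G] X) a = a :=
  hT.multiplicative.push_id (Additive.ofMul a)

theorem nm_comp (g : Y →[G] Z) (f : X →[G] Y) (a : S X) :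
    T.nm (g.comp f) a = T.nm g (T.nm f a) :=
  hT.multiplicative.push_comp g f (Additive.ofMul a)

theorem res_nm {Ω₁ Ω₂ Ω₃ Ω₄ : FinGSet G} {α : Ω₁ →[G] Ω₂} {β : Ω₁ →[G] Ω₃}
    {γ : Ω₂ →[G] Ω₄} {δ : Ω₃ →[G] Ω₄} (h : FinGSet.IsPullbackSquare α β γ δ) (a : S Ω₂) :
    T.res δ (T.nm γ a) = T.nm β (T.res α a) :=
  hT.multiplicative.base_change α β γ δ h (Additive.ofMul a)

theorem nm_split {i : X →[G] Z} {j : Y →[G] Z} (hi : Function.Injective i)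
    (hj : Function.Injective j) (hd : ∀ x y, i x ≠ j y)
    (hc : ∀ z, (∃ x, i x = z) ∨ ∃ y, j y = z) (c : S Z) :
    T.nm i (T.res i c) * T.nm j (T.res j c) = c :=
  hT.multiplicative.split hi hj hd hc (Additive.ofMul c)

end IsSemiTambara

/-! ### The norm of a sum. -/

namespace FinGSet

variable {G : Type u} [Group G] {X Y : FinGSet G}

/-- The codiagonal. -/
def fold (X : FinGSet G) : disjUnion X X →[G] X :=
  sumElim (MulActionHom.id G) (MulActionHom.id G)

/-- The section of `Π_f (X ⊔ X) → Y` with value the first inclusion. -/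
def constInl (f : X →[G] Y) : Y →[G] piSet (fold X) f where
  toFun y := (⟨y, fun x => inl X X x.1, fun _ => rfl⟩ : PiSections (fold X) f)
  map_smul' g _ := PiSections.ext' rfl fun x _ _ =>
    congrArg (inl X X) (smul_inv_smul g x).symm

theorem constInl_injective (f : X →[G] Y) : Function.Injective (constInl f) :=
  fun _ _ h => congrArg (piProj (fold X) f) h

theorem inl_or_inr (t : disjUnion X X) :
    (t = inl X X (fold X t)) ∨ t = inr X X (fold X t) := by
  rcases t with x | x
  · exact .inl rfl
  · exact .inr rfl

theorem fold_piEval (f : X →[G] Y) (z : fibreProduct f (piProj (fold X) f)) :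
    fold X (piEval (fold X) f z) = z.1.1 :=
  z.1.2.2.2 _

/-- The points of `X ×_Y Π_f (X ⊔ X)` over the first summand. -/
abbrev partL (f : X →[G] Y) : FinGSet G := fibreProduct (piEval (fold X) f) (inl X X)

/-- The points of `X ×_Y Π_f (X ⊔ X)` over the second summand. -/
abbrev partR (f : X →[G] Y) : FinGSet G := fibreProduct (piEval (fold X) f) (inr X X)

/-- The projection to `Π_f (X ⊔ X)` of the points over the first summand. -/
def projL (f : X →[G] Y) : partL f →[G] piSet (fold X) f :=
  (piSnd (fold X) f).comp (fibreFst _ _)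

/-- The projection to `Π_f (X ⊔ X)` of the points over the second summand. -/
def projR (f : X →[G] Y) : partR f →[G] piSet (fold X) f :=
  (piSnd (fold X) f).comp (fibreFst _ _)

theorem fibreSnd_partL (f : X →[G] Y) (z : partL f) : z.1.2 = z.1.1.1.1 := by
  rw [← fold_piEval, z.2]; rfl

theorem fibreSnd_partR (f : X →[G] Y) (z : partR f) : z.1.2 = z.1.1.1.1 := by
  rw [← fold_piEval, z.2]; rfl

/-- The points over the first summand and over the section `constInl`. -/
def toPartL (f : X →[G] Y) : X →[G] partL f where
  toFun x := ⟨(⟨(x, constInl f (f x)), rfl⟩, x), rfl⟩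
  map_smul' g x := Subtype.ext (Prod.ext (Subtype.ext (Prod.ext rfl
    ((congrArg (constInl f) (map_smul f g x)).trans (map_smul (constInl f) g (f x))))) rfl)

/-- Over the constant section everything lies in the first summand, so the fibre there is the whole
fibre of `f`. This is the source of the leading term `f_♯ u`. -/
theorem isPullbackSquare_toPartL (f : X →[G] Y) :
    IsPullbackSquare (toPartL f) f (projL f) (constInl f) := by
  refine ⟨fun _ => rfl, fun x x' h => congrArg (fun t => t.1.1.1.2) h, fun ⟨⟨z, y⟩, h⟩ => ?_⟩
  have h' : z.1.1.1.2 = constInl f y := h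
  have hy : f z.1.1.1.1 = y := z.1.1.2.trans (congrArg (piProj (fold X) f) h')
  refine ⟨z.1.1.1.1, Subtype.ext (Prod.ext (Subtype.ext (Prod.ext (Subtype.ext
    (Prod.ext rfl ?_)) (fibreSnd_partL f z).symm)) hy)⟩
  exact (congrArg (constInl f) hy).trans h'.symm

/-- Over the constant section `v` contributes only an empty norm, that is, the factor `1`. -/
theorem projR_ne_constInl (f : X →[G] Y) (z : partR f) (y : Y) : projR f z ≠ constInl f y := by
  intro h
  have hy : f z.1.1.1.1 = y := z.1.1.2.trans (congrArg (piProj (fold X) f) h)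
  have := piEval_eq z.1.1 (constInl f y) h z.1.1.1.1 rfl hy
  exact inl_ne_inr _ _ (this.symm.trans z.2)

end FinGSet

namespace IsSemiTambara

variable {G : Type u} [Group G] {S : FinGSet G → Type w} [∀ X, CommSemiring (S X)]
  {T : TambaraMaps S} (hT : IsSemiTambara T) {X Y Z : FinGSet G}

open FinGSet

include hT in
/-- The norm of a sum: the leading term is the norm of the first summand, the other terms are
indexed by the sections of `Π_f (X ⊔ X)` other than the first inclusion. -/
theorem nm_add (f : X →[G] Y) (u v : S X) :
    T.nm f (u + v) = T.nm f u +
      T.tr ((piProj (fold X) f).comp (complIncl (constInl f)))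
        (T.nm (fibreSnd (projL f) (complIncl (constInl f)))
            (T.res ((fibreSnd _ _).comp (fibreFst (projL f) _)) u) *
          T.nm (fibreSnd (projR f) (complIncl (constInl f)))
            (T.res ((fibreSnd _ _).comp (fibreFst (projR f) _)) v)) := by
  have hA := hT.additive
  -- The sum `u + v` becomes an induction along the codiagonal, to which the exponential axiom
  -- applies.
  obtain ⟨w, hu, hv, hw⟩ : ∃ w : S (disjUnion X X),
      T.res (inl X X) w = u ∧ T.res (inr X X) w = v ∧ T.tr (fold X) w = u + v := by
    refine ⟨T.tr (inl X X) u + T.tr (inr X X) v, hA.res_inl u v, hA.res_inr u v, ?_⟩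
    rw [hA.push_add, ← hA.push_comp, ← hA.push_comp]
    exact congrArg₂ (· + ·) (hA.push_id u) (hA.push_id v)
  have hl : T.res (fibreFst (piEval (fold X) f) (inl X X)) (T.res (piEval (fold X) f) w) =
      T.res (fibreSnd (piEval (fold X) f) (inl X X)) u := by
    rw [← hu, ← hA.res_comp, ← hA.res_comp]
    exact congrArg (T.res · w) (MulActionHom.ext fun z => z.2)
  have hr : T.res (fibreFst (piEval (fold X) f) (inr X X)) (T.res (piEval (fold X) f) w) =
      T.res (fibreSnd (piEval (fold X) f) (inr X X)) v := by
    rw [← hv, ← hA.res_comp, ← hA.res_comp]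
    exact congrArg (T.res · w) (MulActionHom.ext fun z => z.2)
  -- Each point of `X ×_Y Π_f (X ⊔ X)` is sent by its section to exactly one summand, so the norm is
  -- a product of two norms.
  have hd : T.nm (piSnd (fold X) f) (T.res (piEval (fold X) f) w) =
      T.nm (projL f) (T.res (fibreSnd _ _) u) * T.nm (projR f) (T.res (fibreSnd _ _) v) := by
    rw [projL, projR, hT.nm_comp, hT.nm_comp, ← hl, ← hr, ← hT.nm_mul]
    refine congrArg _ (hT.nm_split (fibreFst_injective _ _ (inl_injective X X))
      (fibreFst_injective _ _ (inr_injective X X)) (fun a b h => ?_) (fun z => ?_) _).symm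
    · exact inl_ne_inr _ _ (a.2.symm.trans ((congrArg (piEval (fold X) f) h).trans b.2))
    · exact (inl_or_inr (piEval (fold X) f z)).imp (fun h => ⟨⟨(z, _), h⟩, rfl⟩)
        fun h => ⟨⟨(z, _), h⟩, rfl⟩
  -- After the exponential axiom, `Π_f (X ⊔ X)` is cut into the image of `constInl` and its
  -- complement.
  rw [← hw, hT.exponential _ _ _ _ _ (isExponential_canonical (fold X) f), hd,
    ← hA.split (constInl_injective f) (j := complIncl (constInl f)) Subtype.val_injective
      (fun y z => z.2 y) (fun z => (em (∃ y, constInl f y = z)).imp_right fun h =>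
        ⟨⟨z, fun y hy => h ⟨y, hy⟩⟩, rfl⟩)
      (T.nm (projL f) _ * T.nm (projR f) _), hA.push_add, ← hA.push_comp, ← hA.push_comp]
  have hid : (piProj (fold X) f).comp (constInl f) = MulActionHom.id G := rfl
  rw [hid, hA.push_id, hT.res_mul, hT.res_mul, hT.res_nm (isPullbackSquare_toPartL f),
    hT.res_nm (isPullbackSquare_empty _ _ (projR_ne_constInl f)),
    hT.res_nm (isPullbackSquare_fibreProduct _ _), hT.res_nm (isPullbackSquare_fibreProduct _ _)]
  have := hA.subsingleton_of_isEmpty (FinGSet.empty G)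
  rw [Subsingleton.elim (T.res (fromEmpty (partR f)) _) 1, hT.nm_one, mul_one, ← hA.res_comp,
    ← hA.res_comp, ← hA.res_comp]
  exact congrArg (fun t => T.nm f t + _) (hA.res_id u)

end IsSemiTambara

/-! ### Polynomial maps and their extension to group completions. -/

/-- `φ` is polynomial of degree at most `n`: its `(n + 1)`-fold differences vanish. -/
def HasDegreeLE {M A : Type*} [AddCommMonoid M] [AddCommGroup A] : ℕ → (M → A) → Prop
  | 0, φ => ∀ x y, φ x = φ y
  | n + 1, φ => ∀ h, HasDegreeLE n fun x => φ (x + h) - φ x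

namespace HasDegreeLE

variable {M N A B : Type*} [AddCommMonoid M] [AddCommMonoid N] [AddCommGroup A] [AddCommGroup B]

theorem const (n : ℕ) {φ : M → A} (h : ∀ x y, φ x = φ y) : HasDegreeLE n φ := by
  induction n generalizing φ with
  | zero => exact h
  | succ n ih => exact fun k => ih fun x y => by rw [h (x + k) x, h (y + k) y, sub_self, sub_self]

theorem succ {n : ℕ} {φ : M → A} (h : HasDegreeLE n φ) : HasDegreeLE (n + 1) φ := by
  induction n generalizing φ with
  | zero => exact fun k => const 0 fun x y => by rw [h (x + k) x, h (y + k) y, sub_self, sub_self]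
  | succ n ih => exact fun k => ih (h k)

theorem mono {m n : ℕ} (hmn : m ≤ n) {φ : M → A} (h : HasDegreeLE m φ) : HasDegreeLE n φ := by
  induction hmn with
  | refl => exact h
  | step _ ih => exact ih.succ

theorem add {n : ℕ} {φ ψ : M → A} (hφ : HasDegreeLE n φ) (hψ : HasDegreeLE n ψ) :
    HasDegreeLE n fun x => φ x + ψ x := by
  induction n generalizing φ ψ with
  | zero => exact fun x y => congrArg₂ (· + ·) (hφ x y) (hψ x y)
  | succ n ih =>
    intro k
    simp only [add_sub_add_comm]
    exact ih (hφ k) (hψ k)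

theorem hom_comp {n : ℕ} (g : A →+ B) {φ : M → A} (hφ : HasDegreeLE n φ) :
    HasDegreeLE n fun x => g (φ x) := by
  induction n generalizing φ with
  | zero => exact fun x y => congrArg g (hφ x y)
  | succ n ih =>
    intro k
    simp only [← map_sub]
    exact ih (hφ k)

theorem sub {n : ℕ} {φ ψ : M → A} (hφ : HasDegreeLE n φ) (hψ : HasDegreeLE n ψ) :
    HasDegreeLE n fun x => φ x - ψ x := by
  simp only [sub_eq_add_neg]
  exact hφ.add (hψ.hom_comp negAddMonoidHom)

theorem comp_hom {n : ℕ} {φ : M → A} (hφ : HasDegreeLE n φ) (g : N →+ M) :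
    HasDegreeLE n fun x => φ (g x) := by
  induction n generalizing φ with
  | zero => exact fun x y => hφ _ _
  | succ n ih =>
    intro k
    simp only [map_add]
    exact ih (hφ (g k))

theorem comp_add_right {n : ℕ} {φ : M → A} (hφ : HasDegreeLE n φ) (k : M) :
    HasDegreeLE n fun x => φ (x + k) := by
  -- The translate is a difference plus `φ`. Raising the degree by `succ` first lets this work for
  -- `n = 0` too.
  simpa using (hφ.succ k).add hφ

theorem of_hom (g : M →+ A) : HasDegreeLE 1 g := fun k x y => by simp

/-- Discrete Leibniz rule: each term of the difference of a product has a difference of one factor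
in it. A factor of degree `0` is constant, and multiplication by it is additive. -/
theorem mul {R : Type*} [CommRing R] {m n : ℕ} {φ ψ : M → R} (hφ : HasDegreeLE m φ)
    (hψ : HasDegreeLE n ψ) : HasDegreeLE (m + n) fun x => φ x * ψ x := by
  induction m generalizing n φ ψ with
  | zero =>
    have h : (fun x => φ x * ψ x) = fun x => AddMonoidHom.mulLeft (φ 0) (ψ x) :=
      funext fun x => by rw [hφ x 0]; rfl
    rw [h, Nat.zero_add]
    exact hψ.hom_comp _
  | succ m ihm =>
    induction n generalizing ψ with
    | zero =>
      have h : (fun x => φ x * ψ x) = fun x => AddMonoidHom.mulRight (ψ 0) (φ x) :=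
        funext fun x => by rw [hψ x 0]; rfl
      rw [h]
      exact hφ.hom_comp _
    | succ n ihn =>
      intro k
      have h : (fun x => φ (x + k) * ψ (x + k) - φ x * ψ x) =
          fun x => (φ (x + k) - φ x) * ψ (x + k) + φ x * (ψ (x + k) - ψ x) :=
        funext fun x => by ring
      change HasDegreeLE (m + 1 + n) _
      rw [h]
      exact ((ihm (hφ k) (hψ.comp_add_right k)).mono (by omega)).add
        ((ihn (hψ k)).mono (by omega))

open Algebra GroupCompletion

/-- For `z = a - b`, the difference of `φ` in direction `b` has smaller degree and vanishes on `S`.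
By induction it vanishes at `z`, where it equals `φ a - φ z`. -/
theorem eq_zero_of_forall_of {S : Type*} [CommSemiring S] {n : ℕ}
    {φ : GrothendieckAddGroup S → A} (hφ : HasDegreeLE n φ)
    (h : ∀ a : S, φ (GrothendieckAddGroup.of a) = 0) (z : GrothendieckAddGroup S) : φ z = 0 := by
  induction n generalizing φ z with
  | zero => exact (hφ z (GrothendieckAddGroup.of 0)).trans (h 0)
  | succ n ih =>
    obtain ⟨a, b, rfl⟩ := exists_sub z
    have := ih (hφ (GrothendieckAddGroup.of b)) (fun c => by
      rw [← map_add, h, h, sub_zero]) (GrothendieckAddGroup.of a - GrothendieckAddGroup.of b)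
    rw [sub_add_cancel, h, zero_sub, neg_eq_zero] at this
    exact this

/-- Uniqueness of polynomial extensions, the principle by which identities pass from a semiring to
its group completion. -/
theorem eq_of_forall_of {S : Type*} [CommSemiring S] {m n : ℕ}
    {φ ψ : GrothendieckAddGroup S → A} (hφ : HasDegreeLE m φ) (hψ : HasDegreeLE n ψ)
    (h : ∀ a : S, φ (GrothendieckAddGroup.of a) = ψ (GrothendieckAddGroup.of a))
    (z : GrothendieckAddGroup S) : φ z = ψ z :=
  sub_eq_zero.1 (eq_zero_of_forall_of ((hφ.mono (le_max_left m n)).sub (hψ.mono (le_max_right m n)))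
    (fun a => sub_eq_zero.2 (h a)) z)

/-- Polynomial maps extend to the group completion. -/
theorem exists_extension {S : Type*} [CommSemiring S] {n : ℕ} {φ : S → A} (hφ : HasDegreeLE n φ) :
    ∃ ψ : GrothendieckAddGroup S → A, HasDegreeLE n ψ ∧
      ∀ a, ψ (GrothendieckAddGroup.of a) = φ a := by
  induction n generalizing φ with
  | zero => exact ⟨fun _ => φ 0, const 0 fun _ _ => rfl, fun a => hφ 0 a⟩
  | succ n ih =>
    -- `D b` extends the difference of `φ` in direction `b`. An extension `ψ` with these differences
    -- must satisfy `ψ (a - b) = φ a - D b (a - b)`, which serves as its definition below.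
    choose D hD hDo using fun b => ih (hφ b)
    -- The cocycle relation of differences holds on `S`, hence everywhere by uniqueness.
    have hadd (b c : S) (z : GrothendieckAddGroup S) :
        D (b + c) z = D c (z + GrothendieckAddGroup.of b) + D b z := by
      refine eq_of_forall_of (hD (b + c))
        (((hD c).comp_add_right (GrothendieckAddGroup.of b)).add (hD b)) (fun a => ?_) z
      rw [← map_add, hDo, hDo, hDo, add_assoc]
      abel
    -- The map from `S` need not be injective: equal images mean `c + x = c + y` for some `c`, and
    -- evaluating `D c` at the common image cancels `c`.
    have hof (x y : S) (h : GrothendieckAddGroup.of x = GrothendieckAddGroup.of y) :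
        φ x = φ y := by
      obtain ⟨c, hc⟩ := (AddLocalization.addMonoidOf (⊤ : AddSubmonoid S)).eq_iff_exists.1 h
      have hx := hDo c x
      have hy := hDo c y
      rw [add_comm x, hc, add_comm c.1 y] at hx
      rw [h, hy] at hx
      exact (sub_right_injective hx).symm
    choose s t hst using fun z : GrothendieckAddGroup S => exists_sub z
    -- The value does not depend on the chosen presentation of `z` as a difference.
    have key (a b : S) (z : GrothendieckAddGroup S)
        (hz : z = GrothendieckAddGroup.of a - GrothendieckAddGroup.of b) :
        φ (s z) - D (t z) z = φ a - D b z := by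
      have h₁ := hadd b (t z) z
      have h₂ := hadd (t z) b z
      rw [eq_sub_iff_add_eq.1 hz, hDo] at h₁
      rw [eq_sub_iff_add_eq.1 (hst z), hDo, add_comm, h₁] at h₂
      have h₃ : φ (a + t z) = φ (s z + b) := hof _ _ <| by
        rw [map_add, map_add, ← sub_eq_sub_iff_add_eq_add, ← hz, ← hst]
      rw [h₃] at h₂
      grind
    let ψ : GrothendieckAddGroup S → A := fun z => φ (s z) - D (t z) z
    have hψ (c : S) (z : GrothendieckAddGroup S) :
        ψ (z + GrothendieckAddGroup.of c) - ψ z = D c z := by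
      obtain ⟨a, b, hz⟩ := exists_sub z
      have h₁ := hadd b c z
      have h₂ := hadd c b z
      rw [eq_sub_iff_add_eq.1 hz, hDo] at h₁
      rw [add_comm, h₁] at h₂
      change φ _ - D _ _ - (φ _ - D _ _) = _
      rw [key a b z hz, key (a + c) b _ (by rw [hz, map_add]; abel)]
      grind
    refine ⟨ψ, fun h => ?_, fun a => ?_⟩
    · obtain ⟨c, d, rfl⟩ := exists_sub h
      -- The differences `D` cover directions in `S` only. Direction `c - d` is reached by moving
      -- back along `d` first and comparing two differences from there.
      have hd : (fun z => ψ (z + (GrothendieckAddGroup.of c - GrothendieckAddGroup.of d)) - ψ z) =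
          fun z => D c (z + -GrothendieckAddGroup.of d) - D d (z + -GrothendieckAddGroup.of d) := by
        funext z
        rw [← hψ, ← hψ, neg_add_cancel_right, sub_sub_sub_cancel_right]
        congr 2
        abel
      rw [hd]
      exact ((hD c).comp_add_right _).sub ((hD d).comp_add_right _)
    · change φ _ - D _ _ = _
      rw [key a 0 _ (by rw [map_zero, sub_zero]), hDo, add_zero, sub_self, sub_zero]

end HasDegreeLE

/-! ### The norm is polynomial. -/

namespace FinGSet

variable {G : Type u} [Group G] {X Y Z : FinGSet G}

/-- The fibres of `f` have at most `n` elements. -/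
def FibreLE (f : X →[G] Y) (n : ℕ) : Prop :=
  ∀ y, Nat.card {x : X // f x = y} ≤ n

theorem fibreLE_card (f : X →[G] Y) : FibreLE f (Nat.card X) := fun _ =>
  Nat.card_le_card_of_injective _ Subtype.val_injective

theorem FibreLE.isEmpty {f : X →[G] Y} (h : FibreLE f 0) : IsEmpty X :=
  ⟨fun x => (Finite.card_eq_zero_iff.1 (Nat.le_zero.1 (h (f x)))).false ⟨x, rfl⟩⟩

/-- The map from the fibres of `projL` to those of `f`. -/
def fibreL (f : X →[G] Y) (w : piSet (fold X) f) (z : {z // projL f z = w}) :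
    {x : X // f x = piProj (fold X) f w} :=
  ⟨z.1.1.1.1.1, z.1.1.1.2.trans (congrArg _ z.2)⟩

/-- The map from the fibres of `projR` to those of `f`. -/
def fibreR (f : X →[G] Y) (w : piSet (fold X) f) (z : {z // projR f z = w}) :
    {x : X // f x = piProj (fold X) f w} :=
  ⟨z.1.1.1.1.1, z.1.1.1.2.trans (congrArg _ z.2)⟩

theorem fibreL_injective (f : X →[G] Y) (w : piSet (fold X) f) :
    Function.Injective (fibreL f w) := fun a b h => by
  have h' : a.1.1.1.1.1 = b.1.1.1.1.1 := congrArg Subtype.val h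
  refine Subtype.ext (Subtype.ext (Prod.ext (Subtype.ext (Prod.ext h' (a.2.trans b.2.symm))) ?_))
  rw [fibreSnd_partL, fibreSnd_partL, h']

theorem fibreR_injective (f : X →[G] Y) (w : piSet (fold X) f) :
    Function.Injective (fibreR f w) := fun a b h => by
  have h' : a.1.1.1.1.1 = b.1.1.1.1.1 := congrArg Subtype.val h
  refine Subtype.ext (Subtype.ext (Prod.ext (Subtype.ext (Prod.ext h' (a.2.trans b.2.symm))) ?_))
  rw [fibreSnd_partR, fibreSnd_partR, h']

/-- A section with all values in the first summand is `constInl`, which the complement excludes. -/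
theorem fibreL_not_surjective (f : X →[G] Y) (w : compl (constInl f)) :
    ¬ Function.Surjective (fibreL f w.1) := fun hs => by
  refine w.2 (piProj (fold X) f w.1) (PiSections.ext' rfl fun x hx hx' => ?_)
  obtain ⟨z, hz⟩ := hs ⟨x, hx'⟩
  have hz' : z.1.1.1.1.1 = x := congrArg Subtype.val hz
  have h := piEval_eq z.1.1.1 w.1 z.2 x hz' hx'
  rw [← h, z.1.2]
  change inl X X x = _
  rw [fibreSnd_partL, hz']

/-- The fibre embeds in a fibre of `f` without filling it, so the bound drops by one; this drives
the inductions on the fibre size. -/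
theorem FibreLE.projL {f : X →[G] Y} {n : ℕ} (h : FibreLE f (n + 1)) :
    FibreLE (fibreSnd (FinGSet.projL f) (complIncl (constInl f))) n := fun w => by
  have := Fintype.ofFinite {z // FinGSet.projL f z = w.1}
  have := Fintype.ofFinite {x : X // f x = piProj (fold X) f w.1}
  have h₁ := h (piProj (fold X) f w.1)
  have h₂ := Fintype.card_lt_of_injective_not_surjective _ (fibreL_injective f w.1)
    (fibreL_not_surjective f w)
  rw [Nat.card_congr ((isPullbackSquare_fibreProduct _ _).fibreEquiv w)]
  rw [Nat.card_eq_fintype_card] at h₁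
  refine (Nat.card_eq_fintype_card (α := {z // FinGSet.projL f z = w.1})).trans_le ?_
  omega

/-- No strict drop here: a section may have all its values in the second summand. -/
theorem FibreLE.projR {f : X →[G] Y} {n : ℕ} (h : FibreLE f n) :
    FibreLE (fibreSnd (FinGSet.projR f) (complIncl (constInl f))) n := fun w => by
  rw [Nat.card_congr ((isPullbackSquare_fibreProduct _ _).fibreEquiv w)]
  exact (Nat.card_le_card_of_injective _ (fibreR_injective f w.1)).trans (h _)

end FinGSet

namespace IsSemiTambara

open FinGSet

variable {G : Type u} [Group G] {S : FinGSet G → Type w} [∀ X, CommSemiring (S X)]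
  {T : TambaraMaps S}

/-- Restriction as an additive homomorphism. -/
def resHom (hT : IsSemiTambara T) {X Y : FinGSet G} (f : X →[G] Y) : S Y →+ S X where
  toFun := T.res f
  map_zero' := hT.additive.res_zero f
  map_add' := hT.additive.res_add f

/-- Induction as an additive homomorphism. -/
def trHom (hT : IsSemiTambara T) {X Y : FinGSet G} (f : X →[G] Y) : S X →+ S Y where
  toFun := T.tr f
  map_zero' := hT.additive.push_zero f
  map_add' := hT.additive.push_add f

/-- The norm along a map with fibres of at most `n` elements is polynomial of degree at most
`n`. -/
theorem hasDegreeLE_nm (hT : IsSemiTambara T) {A : Type*} [AddCommGroup A] {n : ℕ}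
    {X Y : FinGSet G} {f : X →[G] Y} (hf : FibreLE f n) (k : S Y →+ A) :
    HasDegreeLE n fun a => k (T.nm f a) := by
  induction n generalizing X Y with
  | zero =>
    have := hf.isEmpty
    have := hT.additive.subsingleton_of_isEmpty X
    exact HasDegreeLE.const 0 fun x y => by rw [Subsingleton.elim x y]
  | succ n ih =>
    intro v
    -- The leading terms cancel. What remains is a norm of `u` with smaller fibres, followed by
    -- multiplication by a fixed norm of `v`, induction and `k`; this composite is the new additive
    -- map `k`.
    simp only [hT.nm_add, map_add, add_sub_cancel_left]
    exact (ih hf.projL ((k.comp (hT.trHom _)).comp (AddMonoidHom.mulRight _))).comp_hom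
      (hT.resHom _)

end IsSemiTambara

/-! ### The Tambara structure on the group completions. -/

namespace GroupCompletion

open Algebra FinGSet

variable {G : Type u} [Group G] {S : FinGSet G → Type w} [∀ X, CommSemiring (S X)]
  {T : TambaraMaps S} (hT : IsSemiTambara T) {X Y Z : FinGSet G}

/-- Restriction on the group completions. -/
noncomputable def resHom (f : X →[G] Y) :
    GrothendieckAddGroup (S Y) →+ GrothendieckAddGroup (S X) :=
  GrothendieckAddGroup.lift (GrothendieckAddGroup.of.comp (hT.resHom f))

/-- Induction on the group completions. -/
noncomputable def trHom (f : X →[G] Y) : GrothendieckAddGroup (S X) →+ GrothendieckAddGroup (S Y) :=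
  GrothendieckAddGroup.lift (GrothendieckAddGroup.of.comp (hT.trHom f))

/-- The norm on the group completions: the polynomial extension. -/
noncomputable def nmExt (f : X →[G] Y) : GrothendieckAddGroup (S X) → GrothendieckAddGroup (S Y) :=
  (hT.hasDegreeLE_nm (fibreLE_card f) GrothendieckAddGroup.of).exists_extension.choose

theorem resHom_of (f : X →[G] Y) (a : S Y) :
    resHom hT f (GrothendieckAddGroup.of a) = GrothendieckAddGroup.of (T.res f a) :=
  lift_of _ a

theorem trHom_of (f : X →[G] Y) (a : S X) :
    trHom hT f (GrothendieckAddGroup.of a) = GrothendieckAddGroup.of (T.tr f a) :=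
  lift_of _ a

theorem nmExt_of (f : X →[G] Y) (a : S X) :
    nmExt hT f (GrothendieckAddGroup.of a) = GrothendieckAddGroup.of (T.nm f a) :=
  (hT.hasDegreeLE_nm (fibreLE_card f) GrothendieckAddGroup.of).exists_extension.choose_spec.2 a

theorem hasDegreeLE_nmExt (f : X →[G] Y) : HasDegreeLE (Nat.card X) (nmExt hT f) :=
  (hT.hasDegreeLE_nm (fibreLE_card f) GrothendieckAddGroup.of).exists_extension.choose_spec.1

/-- Restriction, induction and norm on the group completions. -/
noncomputable def maps : TambaraMaps fun X => GrothendieckAddGroup (S X) where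
  res f := resHom hT f
  tr f := trHom hT f
  nm f := nmExt hT f

theorem of_mul {R : Type*} [CommSemiring R] (a b : R) : GrothendieckAddGroup.of (a * b) =
    GrothendieckAddGroup.of a * GrothendieckAddGroup.of b :=
  (mulHom_of a b).symm

/-- Maps of two variables that are polynomial in each of them agree if they agree on `S × S'`. -/
theorem eq_of_forall_of₂ {R R' : Type*} [CommSemiring R] [CommSemiring R'] {A : Type*}
    [AddCommGroup A] {m n : ℕ} {φ ψ : GrothendieckAddGroup R → GrothendieckAddGroup R' → A}
    (hφ₁ : ∀ b, HasDegreeLE m fun a => φ a b) (hφ₂ : ∀ a, HasDegreeLE n fun b => φ a b)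
    (hψ₁ : ∀ b, HasDegreeLE m fun a => ψ a b) (hψ₂ : ∀ a, HasDegreeLE n fun b => ψ a b)
    (h : ∀ a b, φ (GrothendieckAddGroup.of a) (GrothendieckAddGroup.of b) =
      ψ (GrothendieckAddGroup.of a) (GrothendieckAddGroup.of b)) (a b) : φ a b = ψ a b :=
  (hφ₁ b).eq_of_forall_of (hψ₁ b) (fun a => (hφ₂ _).eq_of_forall_of (hψ₂ _) (h a) b) a

theorem resHom_mul (f : X →[G] Y) (a b : GrothendieckAddGroup (S Y)) :
    resHom hT f (a * b) = resHom hT f a * resHom hT f b :=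
  eq_of_forall_of₂ (m := 1) (n := 1) (φ := fun a b => resHom hT f (a * b))
    (ψ := fun a b => resHom hT f a * resHom hT f b)
    (fun b => HasDegreeLE.of_hom ((resHom hT f).comp (AddMonoidHom.mulRight b)))
    (fun a => HasDegreeLE.of_hom ((resHom hT f).comp (AddMonoidHom.mulLeft a)))
    (fun b => HasDegreeLE.of_hom ((AddMonoidHom.mulRight _).comp (resHom hT f)))
    (fun a => HasDegreeLE.of_hom ((AddMonoidHom.mulLeft _).comp (resHom hT f)))
    (fun a b => by
      simp only [← of_mul, resHom_of, hT.res_mul]) a b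

theorem nmExt_mul (f : X →[G] Y) (a b : GrothendieckAddGroup (S X)) :
    nmExt hT f (a * b) = nmExt hT f a * nmExt hT f b :=
  eq_of_forall_of₂ (φ := fun a b => nmExt hT f (a * b))
    (ψ := fun a b => nmExt hT f a * nmExt hT f b)
    (fun b => (hasDegreeLE_nmExt hT f).comp_hom (AddMonoidHom.mulRight b))
    (fun a => (hasDegreeLE_nmExt hT f).comp_hom (AddMonoidHom.mulLeft a))
    (fun b => (hasDegreeLE_nmExt hT f).hom_comp (AddMonoidHom.mulRight _))
    (fun a => (hasDegreeLE_nmExt hT f).hom_comp (AddMonoidHom.mulLeft _))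
    (fun a b => by
      simp only [← of_mul, nmExt_of, hT.nm_mul]) a b

/-- Both sides are polynomial in `u` and in `v` separately, so the identity extends from `S X`. Only
the shape of the formula matters, so the maps in it are arbitrary. -/
theorem nmExt_add_of {X₁ X₂ W : FinGSet G} (f : X →[G] Y) (r : W →[G] Y) (f₁ : X₁ →[G] W)
    (f₂ : X₂ →[G] W) (e₁ : X₁ →[G] X) (e₂ : X₂ →[G] X)
    (h : ∀ a b : S X, T.nm f (a + b) =
      T.nm f a + T.tr r (T.nm f₁ (T.res e₁ a) * T.nm f₂ (T.res e₂ b)))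
    (u v : GrothendieckAddGroup (S X)) :
    nmExt hT f (u + v) = nmExt hT f u +
      trHom hT r (nmExt hT f₁ (resHom hT e₁ u) * nmExt hT f₂ (resHom hT e₂ v)) := by
  obtain ⟨n₁, h₁⟩ : ∃ n, HasDegreeLE n (nmExt hT f) := ⟨_, hasDegreeLE_nmExt hT f⟩
  obtain ⟨n₂, h₂⟩ : ∃ n, HasDegreeLE n fun u => nmExt hT f₁ (resHom hT e₁ u) :=
    ⟨_, (hasDegreeLE_nmExt hT f₁).comp_hom (resHom hT e₁)⟩
  obtain ⟨n₃, h₃⟩ : ∃ n, HasDegreeLE n fun v => nmExt hT f₂ (resHom hT e₂ v) :=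
    ⟨_, (hasDegreeLE_nmExt hT f₂).comp_hom (resHom hT e₂)⟩
  -- The summand `0` in the bounds is the degree of the factor held constant, in the form that
  -- `HasDegreeLE.mul` produces.
  have k₁ (v) : HasDegreeLE (max n₁ (n₂ + 0)) fun u => nmExt hT f (u + v) :=
    (h₁.comp_add_right v).mono (le_max_left _ _)
  have k₂ (u) : HasDegreeLE (max n₁ (0 + n₃)) fun v => nmExt hT f (u + v) := by
    simp only [add_comm u]
    exact (h₁.comp_add_right u).mono (le_max_left _ _)
  have k₃ (v) : HasDegreeLE (max n₁ (n₂ + 0)) fun u => nmExt hT f u +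
      trHom hT r (nmExt hT f₁ (resHom hT e₁ u) * nmExt hT f₂ (resHom hT e₂ v)) := by
    have hc : HasDegreeLE 0 fun _ : GrothendieckAddGroup (S X) => nmExt hT f₂ (resHom hT e₂ v) :=
      fun _ _ => rfl
    exact (h₁.mono (le_max_left _ _)).add
      (((h₂.mul hc).hom_comp (trHom hT r)).mono (le_max_right _ _))
  have k₄ (u) : HasDegreeLE (max n₁ (0 + n₃)) fun v => nmExt hT f u +
      trHom hT r (nmExt hT f₁ (resHom hT e₁ u) * nmExt hT f₂ (resHom hT e₂ v)) := by
    have hc : HasDegreeLE 0 fun _ : GrothendieckAddGroup (S X) => nmExt hT f₁ (resHom hT e₁ u) :=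
      fun _ _ => rfl
    exact (HasDegreeLE.const _ fun _ _ => rfl).add
      (((hc.mul h₃).hom_comp (trHom hT r)).mono (le_max_right _ _))
  refine eq_of_forall_of₂ k₁ k₂ k₃ k₄ (fun a b => ?_) u v
  simp only [← map_add, resHom_of, nmExt_of, ← of_mul, trHom_of, h]

theorem nmExt_add (f : X →[G] Y) (u v : GrothendieckAddGroup (S X)) :
    nmExt hT f (u + v) = nmExt hT f u +
      trHom hT ((piProj (fold X) f).comp (complIncl (constInl f)))
        (nmExt hT (fibreSnd (projL f) (complIncl (constInl f)))
            (resHom hT ((fibreSnd _ _).comp (fibreFst (projL f) _)) u) *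
          nmExt hT (fibreSnd (projR f) (complIncl (constInl f)))
            (resHom hT ((fibreSnd _ _).comp (fibreFst (projR f) _)) v)) :=
  nmExt_add_of hT f _ _ _ _ _ (hT.nm_add f) u v

include hT in
theorem subsingleton_of_isEmpty (X : FinGSet G) [h : IsEmpty X] :
    Subsingleton (GrothendieckAddGroup (S X)) := by
  have := hT.additive.subsingleton_of_isEmpty X
  refine subsingleton_of_forall_eq 0 fun z => ?_
  obtain ⟨a, b, rfl⟩ := exists_sub z
  rw [Subsingleton.elim a b, sub_self]

/-- The norm takes polynomial maps to polynomial maps. -/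
theorem exists_hasDegreeLE_nmExt_comp (M : Type*) [AddCommMonoid M] (n d : ℕ) :
    ∃ N, ∀ {X Y : FinGSet G} (f : X →[G] Y), FibreLE f n →
      ∀ c : M → GrothendieckAddGroup (S X), HasDegreeLE d c →
        HasDegreeLE N fun x => nmExt hT f (c x) := by
  induction n generalizing d with
  | zero =>
    refine ⟨0, fun f hf c _ => HasDegreeLE.const 0 fun x y => ?_⟩
    have := subsingleton_of_isEmpty hT _ (h := hf.isEmpty)
    rw [Subsingleton.elim (c x) (c y)]
  | succ n ihn =>
    -- Double induction on fibre size and degree. The bound `N` must be uniform in the map, since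
    -- the hypotheses are used for the other maps in `nmExt_add`.
    induction d with
    | zero => exact ⟨0, fun f hf c hc => HasDegreeLE.const 0 fun x y => by rw [hc x y]⟩
    | succ d ihd =>
      obtain ⟨N₁, h₁⟩ := ihn (d + 1)
      obtain ⟨N₂, h₂⟩ := ihd
      -- The difference in direction `h` is induced from a product: the first factor has smaller
      -- fibres and the same degree `d + 1`, the second has the same fibre bound but involves a
      -- difference of `c`, of degree `d`. The `1` accounts for taking the difference.
      refine ⟨N₁ + N₂ + 1, fun f hf c hc h => ?_⟩
      have he (x : M) := nmExt_add hT f (c x) (c (x + h) - c x)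
      simp only [add_sub_cancel] at he
      rw [funext fun x => sub_eq_of_eq_add' (he x)]
      exact ((h₁ _ hf.projL _ (hc.hom_comp (resHom hT _))).mul
        (h₂ _ hf.projR _ ((hc h).hom_comp (resHom hT _)))).hom_comp (trHom hT _)

theorem nmExt_id (a : GrothendieckAddGroup (S X)) : nmExt hT (MulActionHom.id G : X →[G] X) a = a :=
  (hasDegreeLE_nmExt hT _).eq_of_forall_of (HasDegreeLE.of_hom (AddMonoidHom.id _))
    (fun a => by rw [nmExt_of, hT.nm_id]; rfl) a

/-- Here two norms are applied in succession, so the degree of the right-hand side must come from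
`exists_hasDegreeLE_nmExt_comp`. -/
theorem nmExt_comp (g : Y →[G] Z) (f : X →[G] Y) (a : GrothendieckAddGroup (S X)) :
    nmExt hT (g.comp f) a = nmExt hT g (nmExt hT f a) := by
  obtain ⟨N, hN⟩ := exists_hasDegreeLE_nmExt_comp hT (GrothendieckAddGroup (S X)) (Nat.card Y)
    (Nat.card X)
  exact (hasDegreeLE_nmExt hT _).eq_of_forall_of
    (hN g (fibreLE_card g) _ (hasDegreeLE_nmExt hT f))
    (fun a => by rw [nmExt_of, nmExt_of, nmExt_of, hT.nm_comp]) a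

theorem resHom_id (a : GrothendieckAddGroup (S X)) :
    resHom hT (MulActionHom.id G : X →[G] X) a = a :=
  DFunLike.congr_fun (hom_ext (ψ := AddMonoidHom.id _) fun a => by
    rw [resHom_of, hT.additive.res_id]; rfl) a

theorem trHom_id (a : GrothendieckAddGroup (S X)) :
    trHom hT (MulActionHom.id G : X →[G] X) a = a :=
  DFunLike.congr_fun (hom_ext (ψ := AddMonoidHom.id _) fun a => by
    rw [trHom_of, hT.additive.push_id]; rfl) a

theorem res_tr {Ω₁ Ω₂ Ω₃ Ω₄ : FinGSet G} {α : Ω₁ →[G] Ω₂} {β : Ω₁ →[G] Ω₃} {γ : Ω₂ →[G] Ω₄}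
    {δ : Ω₃ →[G] Ω₄} (h : IsPullbackSquare α β γ δ) (a : GrothendieckAddGroup (S Ω₂)) :
    resHom hT δ (trHom hT γ a) = trHom hT β (resHom hT α a) :=
  DFunLike.congr_fun (hom_ext (φ := (resHom hT δ).comp (trHom hT γ))
    (ψ := (trHom hT β).comp (resHom hT α)) fun a => by
      simp only [AddMonoidHom.comp_apply, resHom_of, trHom_of, hT.additive.base_change _ _ _ _ h]) a

theorem res_nm {Ω₁ Ω₂ Ω₃ Ω₄ : FinGSet G} {α : Ω₁ →[G] Ω₂} {β : Ω₁ →[G] Ω₃} {γ : Ω₂ →[G] Ω₄}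
    {δ : Ω₃ →[G] Ω₄} (h : IsPullbackSquare α β γ δ) (a : GrothendieckAddGroup (S Ω₂)) :
    resHom hT δ (nmExt hT γ a) = nmExt hT β (resHom hT α a) :=
  ((hasDegreeLE_nmExt hT γ).hom_comp (resHom hT δ)).eq_of_forall_of
    ((hasDegreeLE_nmExt hT β).comp_hom (resHom hT α))
    (fun a => by simp only [resHom_of, nmExt_of, hT.res_nm h]) a

theorem isSemiMackey_tr : IsSemiMackey (fun X => GrothendieckAddGroup (S X)) (maps hT).res
    (maps hT).tr where
  res_zero f := map_zero (resHom hT f)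
  res_add f := map_add (resHom hT f)
  push_zero f := map_zero (trHom hT f)
  push_add f := map_add (trHom hT f)
  res_id := resHom_id hT
  res_comp g f a := DFunLike.congr_fun (hom_ext (φ := resHom hT (g.comp f))
    (ψ := (resHom hT f).comp (resHom hT g)) fun a => by
      simp only [AddMonoidHom.comp_apply, resHom_of, hT.additive.res_comp]) a
  push_id := trHom_id hT
  push_comp g f a := DFunLike.congr_fun (hom_ext (φ := trHom hT (g.comp f))
    (ψ := (trHom hT g).comp (trHom hT f)) fun a => by
      simp only [AddMonoidHom.comp_apply, trHom_of, hT.additive.push_comp]) a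
  base_change _ _ _ _ h := res_tr hT h
  disjUnion Ω Ψ := disjUnion_bijective (S := fun X => GrothendieckAddGroup (S X)) (maps hT).res
    (maps hT).tr (fun f => map_add (resHom hT f)) (fun f => map_zero (trHom hT f)) (resHom_id hT)
    (trHom_id hT) (fun _ _ _ _ h => res_tr hT h) (subsingleton_of_isEmpty hT _) Ω Ψ fun c =>
      DFunLike.congr_fun (hom_ext (φ := (trHom hT (inl Ω Ψ)).comp (resHom hT (inl Ω Ψ)) +
        (trHom hT (inr Ω Ψ)).comp (resHom hT (inr Ω Ψ))) (ψ := AddMonoidHom.id _) fun a => by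
          simp only [AddMonoidHom.add_apply, AddMonoidHom.comp_apply, resHom_of, trHom_of,
            ← map_add, hT.additive.split_inl_inr, AddMonoidHom.id_apply]) c

theorem isSemiMackey_nm : IsSemiMackey (fun X => Additive (GrothendieckAddGroup (S X)))
    (fun f a => Additive.ofMul ((maps hT).res f a.toMul))
    (fun f a => Additive.ofMul ((maps hT).nm f a.toMul)) where
  res_zero f := (resHom_of hT f 1).trans (congrArg _ (hT.res_one f))
  res_add f := resHom_mul hT f
  push_zero f := (nmExt_of hT f 1).trans (congrArg _ (hT.nm_one f))
  push_add f := nmExt_mul hT f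
  res_id := resHom_id hT
  res_comp g f := (isSemiMackey_tr hT).res_comp g f
  push_id := nmExt_id hT
  push_comp g f := nmExt_comp hT g f
  base_change _ _ _ _ h := res_nm hT h
  disjUnion Ω Ψ := disjUnion_bijective (S := fun X => Additive (GrothendieckAddGroup (S X)))
    (fun f a => Additive.ofMul ((maps hT).res f a.toMul))
    (fun f a => Additive.ofMul ((maps hT).nm f a.toMul))
    (resHom_mul hT) (fun f => (nmExt_of hT f 1).trans (congrArg _ (hT.nm_one f)))
    (resHom_id hT) (nmExt_id hT) (fun _ _ _ _ h => res_nm hT h)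
    (subsingleton_of_isEmpty hT (FinGSet.empty G)) Ω Ψ fun c => by
      have h₁ := (hasDegreeLE_nmExt hT (inl Ω Ψ)).comp_hom (resHom hT (inl Ω Ψ))
      have h₂ := (hasDegreeLE_nmExt hT (inr Ω Ψ)).comp_hom (resHom hT (inr Ω Ψ))
      exact (h₁.mul h₂).eq_of_forall_of (HasDegreeLE.of_hom (AddMonoidHom.id _)) (fun a => by
        simp only [resHom_of, nmExt_of, ← of_mul]
        exact congrArg _ (hT.multiplicative.split_inl_inr (Additive.ofMul a))) c

/-- The group completion of a semi-Tambara functor is a Tambara functor. -/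
theorem isTambara_maps : IsTambara (maps hT) where
  additive := isSemiMackey_tr hT
  multiplicative := isSemiMackey_nm hT
  exponential e p f f' q h a :=
    ((hasDegreeLE_nmExt hT f).comp_hom (trHom hT p)).eq_of_forall_of
      (((hasDegreeLE_nmExt hT f').comp_hom (resHom hT e)).hom_comp (trHom hT q))
      (fun a => by simp only [trHom_of, nmExt_of, resHom_of, hT.exponential _ _ _ _ _ h]) a
  tr_neg f := map_neg (trHom hT f)

theorem isTambaraHom_of : IsTambaraHom T (maps hT) fun _ => GrothendieckAddGroup.of where
  map_zero _ := map_zero _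
  map_one _ := rfl
  map_add _ := map_add _
  map_mul _ := of_mul
  map_res f a := (resHom_of hT f a).symm
  map_tr f a := (trHom_of hT f a).symm
  map_nm f a := (nmExt_of hT f a).symm

/-- Additive maps are determined on the image of `S`. So are the norms of `T'`: being part of a
semi-Tambara structure, they are themselves polynomial. -/
theorem eq_maps {T' : TambaraMaps fun X => GrothendieckAddGroup (S X)} (hT' : IsTambara T')
    (h : IsTambaraHom T T' fun _ => GrothendieckAddGroup.of) : T' = maps hT := by
  have hs := hT'.toIsSemiTambara
  have hres {X Y : FinGSet G} (f : X →[G] Y) : T'.res f = (maps hT).res f :=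
    funext fun z => DFunLike.congr_fun (hom_ext (φ := hs.resHom f) (ψ := resHom hT f) fun a =>
      (h.map_res f a).symm.trans (resHom_of hT f a).symm) z
  have htr {X Y : FinGSet G} (f : X →[G] Y) : T'.tr f = (maps hT).tr f :=
    funext fun z => DFunLike.congr_fun (hom_ext (φ := hs.trHom f) (ψ := trHom hT f) fun a =>
      (h.map_tr f a).symm.trans (trHom_of hT f a).symm) z
  have hnm {X Y : FinGSet G} (f : X →[G] Y) : T'.nm f = (maps hT).nm f :=
    -- The values of `T'` are already groups, so the additive map `k` can be the identity.
    funext fun z => (hs.hasDegreeLE_nm (fibreLE_card f) (AddMonoidHom.id _)).eq_of_forall_of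
      (hasDegreeLE_nmExt hT f) (fun a => (h.map_nm f a).symm.trans (nmExt_of hT f a).symm) z
  cases T'
  simp only [maps, TambaraMaps.mk.injEq]
  exact ⟨funext fun X => funext fun Y => funext fun f => hres f,
    funext fun X => funext fun Y => funext fun f => htr f,
    funext fun X => funext fun Y => funext fun f => hnm f⟩

end GroupCompletion

theorem mainTheorem10 (G : Type u) [Group G] [Finite G] (K : Type u) [Field K] [CharZero K] :
    IsSemiTambara (KPlus.maps K G) ∧
    ∃! T : TambaraMaps (fun X : FinGSet G => KGroup K X),
      IsTambara T ∧
        IsTambaraHom (KPlus.maps K G) T (fun _ => Algebra.GrothendieckAddGroup.of) := by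
  have h := KPlus.isSemiTambara_maps K G
  exact ⟨h, GroupCompletion.maps h,
    ⟨GroupCompletion.isTambara_maps h, GroupCompletion.isTambaraHom_of h⟩,
    fun _ hT => GroupCompletion.eq_maps h hT.1 hT.2⟩
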